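/- Let $\mathcal A$ be an alphabet and $F(\mathcal A)$ the free group on $\mathcal A$. Positive words are words in the letters of $\mathcal A$ (without inverses); two positive words are related if they contain each letter the same number of times. A positive word $w$ is a cyclic block interchange of $v$ if some cyclic permutations $v'$ of $v$ and $w'$ of $w$ can be written $v'=w_1w_2w_3w_4$ and $w'=w_1w_4w_3w_2$ with (possibly empty) positive words $w_i$. For related $v,w$ let $\mathrm d_{\mathrm{cbi}}(v,w)=0$ if $w$ is a cyclic permutation of $v$, and otherwise let it be the least $k$ for which there are positive words $v=z^0,\dots,z^k=w$ with each $z^i$ a cyclic block interchange of $z^{i-1}$. For a group $G$ and $g\in[G,G]$ let $\mathrm{cl}_G(g)$ be the least $k$ such that $g$ is a product of $k$ commutators, and for $g_1,\dots,g_n\in G$ with $g_1\cdots g_n\in[G,G]$ let $\mathrm{cl}_G(g_1+\dots+g_n)=\min_{t_1,\dots,t_n\in G}\mathrm{cl}_G(t_1g_1t_1^{-1}\cdots t_ng_nt_n^{-1})$. (i) If $v,w$ are related positive words over $\mathcal A$, then $\mathrm d_{\mathrm{cbi}}(v,w)$ is finite and $$\mathrm d_{\mathrm{cbi}}(v,w)=\mathrm{cl}_{F(\mathcal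 A)}(v+w^{-1})=\min\{\mathrm{cl}_{F(\mathcal A)}(v\tilde w^{-1}) : \tilde w\text{ a cyclic permutation of }w\}.$$ (ii) Let $\mathcal A$ be finite. Let CBI-$\mathcal A$ be the problem of deciding, for related positive words $v,w$ and $k\in\mathbb N$, whether $\mathrm d_{\mathrm{cbi}}(v,w)\le k$, with input size $|v|+|w|$; let CL-$F(\mathcal A)$ be the problem of deciding, for a word $g$ over $\mathcal A\cup\mathcal A^{-1}$ representing an element of $[F(\mathcal A),F(\mathcal A)]$ and $k\in\mathbb N$, whether $\mathrm{cl}_{F(\mathcal A)}(g)\le k$, with input size $|g|+k$ (in both problems $k$ is written in unary). Then CBI-$\mathcal A$ is reducible to CL-$F(\mathcal A)$ in polynomial time, in the following sense: there is a deterministic Turing machine which, given an input $(v,w,k)$ of CBI-$\mathcal A$, writes down, in time polynomial in $|v|+|w|$, a finite list of inputs of CL-$F(\mathcal A)$ such that $\mathrm d_{\mathrm{cbi}}(v,w)\le k$ if and only if the answer to at least one of them is "yes". -/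

import Mathlib

/-! ### Commutator length of elements and of chains -/

section CommutatorLength

variable {G : Type*} [Group G]

/-- The commutator length of `g`: the least `k` such that
`g = [x₁, y₁] ⋯ [x_k, y_k]` where `[x, y] = x y x⁻¹ y⁻¹`. It is `⊤` exactly when `g` is not a product
of commutators, that is, when `g` does not lie in the commutator subgroup. -/
noncomputable def commutatorLength (g : G) : ℕ∞ :=
  ⨅ k ∈ {k : ℕ | ∃ x y : Fin k → G, g = (List.ofFn fun i => x i * y i * (x i)⁻¹ * (y i)⁻¹).prod}, (k : ℕ∞)

/-- The commutator length of a formal sum `g₁ + ⋯ + gₙ` (given as the list of its terms):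
the minimum of the commutator lengths of `(t₁ g₁ t₁⁻¹) ⋯ (tₙ gₙ tₙ⁻¹)` over all `t₁, …, tₙ`. -/
noncomputable def chainCommutatorLength (c : List G) : ℕ∞ :=
  ⨅ t : Fin c.length → G,
    commutatorLength (List.ofFn fun i => t i * c.get i * (t i)⁻¹).prod

end CommutatorLength

/-! ### Positive words and cyclic block interchanges

A positive word over the alphabet `A` is a list of letters; the cyclic permutations of a word are
its rotations. -/

section Words

variable {A : Type*}

/-- The element of the free group `F(A)` represented by a positive word. -/
def posWord (v : List A) : FreeGroup A := (v.map FreeGroup.of).prod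

/-- Two positive words are related if they contain every letter the same number of times, i.e. if
one is a rearrangement of the other. -/
def Related (v w : List A) : Prop := v.Perm w

/-- `w` is a cyclic block interchange of `v`. -/
def IsCyclicBlockInterchange (v w : List A) : Prop :=
  ∃ v' w' : List A, v.IsRotated v' ∧ w.IsRotated w' ∧
    ∃ w₁ w₂ w₃ w₄ : List A, v' = w₁ ++ w₂ ++ w₃ ++ w₄ ∧ w' = w₁ ++ w₄ ++ w₃ ++ w₂

open Classical in
/-- The cyclic block interchange distance: `0` if `w` is a cyclic permutation of `v`, and
otherwise the least length `k` of a sequence `v = z⁰, …, zᵏ = w` in which each word is a cyclic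
block interchange of the one before (`⊤` if there were no such sequence). -/
noncomputable def cbiDist (v w : List A) : ℕ∞ :=
  if v.IsRotated w then 0
  else ⨅ k ∈ {k : ℕ | ∃ z : ℕ → List A, z 0 = v ∧ z k = w ∧
      ∀ i < k, IsCyclicBlockInterchange (z i) (z (i + 1))}, (k : ℕ∞)

end Words

/-! ### Decision problems and polynomial-time reductions -/

/-- A decision problem: a type of admissible inputs, written down faithfully as strings over a
finite set of symbols, with a notion of input size, and the set of inputs with answer "yes". -/
structure DecisionProblem where
  /-- the admissible inputs -/
  Instance : Type
  /-- the symbols in which inputs are written -/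
  Symbol : Type
  finite_symbol : Finite Symbol
  /-- the string that represents an input -/
  encode : Instance → List Symbol
  encode_injective : Function.Injective encode
  /-- the size of an input, in terms of which running times are measured -/
  size : Instance → ℕ
  /-- the answer to an input is "yes" -/
  Yes : Instance → Prop

/-- A finite list of inputs as one string; the symbol `none` terminates each of them. -/
def DecisionProblem.encodeList (P : DecisionProblem) (l : List P.Instance) :
    List (Option P.Symbol) :=
  l.flatMap fun x => (P.encode x).map some ++ [none]

/-- `f` is computed by a deterministic Turing machine (with finitely many tapes, used as stacks,
and finite tape alphabets) in a number of steps that is at most a polynomial in `size a`: when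
started with the string `ea a` on its input stack and with all other stacks empty, the machine
halts within that time with exactly the string `eb (f a)` on its output stack. -/
def PolyTimeComputable {α β Γ₀ Γ₁ : Type} (size : α → ℕ)
    (ea : α → List Γ₀) (eb : β → List Γ₁) (f : α → β) : Prop :=
  ∃ (M : Turing.TM2ComputableAux Γ₀ Γ₁) (p : Polynomial ℕ),
    (∀ k, Finite (M.tm.Γ k)) ∧
    ∀ a : α, ∃ c : M.tm.Cfg,
      Nonempty (StateTransition.EvalsToInTime M.tm.step
        (Turing.initList M.tm ((ea a).map M.inputAlphabet.symm)) (some c) (p.eval (size a))) ∧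
      c.l = none ∧
      c.stk M.tm.k₁ = (eb (f a)).map M.outputAlphabet.symm

/-- There is a polynomial-time (disjunctive truth-table) reduction from `P` to `Q`: from an input
of `P` one can compute, in time polynomial in its size, a finite list of inputs of `Q`, such that
the answer to the input of `P` is "yes" iff the answer to at least one member of the list is. -/
def PolyTimeReducible (P Q : DecisionProblem) : Prop :=
  ∃ f : P.Instance → List Q.Instance,
    PolyTimeComputable P.size P.encode Q.encodeList f ∧
    ∀ x, P.Yes x ↔ ∃ y ∈ f x, Q.Yes y

section Problems

theorem map_inl_append_inr_inj {B C : Type*} {c : C} :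
    ∀ {v v' : List B} {r r' : List (B ⊕ C)},
      v.map Sum.inl ++ Sum.inr c :: r = v'.map Sum.inl ++ Sum.inr c :: r' → v = v' ∧ r = r'
  | [], [], _, _, h => by simpa using h
  | [], b :: v', _, _, h => by simp at h
  | b :: v, [], _, _, h => by simp at h
  | b :: v, b' :: v', r, r', h => by
    simp only [List.map_cons, List.cons_append, List.cons.injEq, Sum.inl.injEq] at h
    obtain ⟨h₁, h₂⟩ := map_inl_append_inr_inj h.2
    exact ⟨by rw [h.1, h₁], h₂⟩

theorem map_inl_append_replicate_inj {B C : Type*} {c : C} {v v' : List B} {k k' : ℕ}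
    (h : v.map (Sum.inl : B → B ⊕ C) ++ List.replicate k (Sum.inr c) =
      v'.map Sum.inl ++ List.replicate k' (Sum.inr c)) : v = v' ∧ k = k' := by
  have h' := congrArg (fun l => l ++ [Sum.inr c]) h
  simp only [List.append_assoc, ← List.replicate_succ', List.replicate_succ] at h'
  obtain ⟨h₁, h₂⟩ := map_inl_append_inr_inj h'
  exact ⟨h₁, by simpa using congrArg List.length h₂⟩

variable (A : Type) [Finite A]

/-- The decision problem CBI-`A`: given related positive words `v`, `w` and `k : ℕ`, decide whether
the cyclic block interchange distance of `v` and `w` is at most `k`. The input is written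
`v # w # 1ᵏ`, where `#` is `Sum.inr false` and `1` is `Sum.inr true`; its size is `|v| + |w|`. -/
noncomputable def CBI : DecisionProblem where
  Instance := {x : List A × List A × ℕ // Related x.1 x.2.1}
  Symbol := A ⊕ Bool
  finite_symbol := inferInstance
  encode x :=
    x.1.1.map Sum.inl ++ Sum.inr false ::
      (x.1.2.1.map Sum.inl ++ Sum.inr false :: List.replicate x.1.2.2 (Sum.inr true))
  encode_injective := by
    rintro ⟨⟨v, w, k⟩, _⟩ ⟨⟨v', w', k'⟩, _⟩ h
    obtain ⟨h₁, h⟩ := map_inl_append_inr_inj h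
    obtain ⟨h₂, h⟩ := map_inl_append_inr_inj h
    have h₃ : k = k' := by simpa using congrArg List.length h
    simp_all
  size x := x.1.1.length + x.1.2.1.length
  Yes x := cbiDist x.1.1 x.1.2.1 ≤ (x.1.2.2 : ℕ∞)

/-- The decision problem CL-`F(A)`: given a word `g` in the letters of `A` and their inverses which
represents an element of the commutator subgroup of `F(A)`, and `k : ℕ`, decide whether the
commutator length of that element is at most `k`. A letter `(a, true)` stands for `a` and
`(a, false)` for `a⁻¹`. The input is written `g 1ᵏ`, where `1` is `Sum.inr ()`; its size is
`|g| + k`. -/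
noncomputable def CLFree : DecisionProblem where
  Instance := {x : List (A × Bool) × ℕ // FreeGroup.mk x.1 ∈ commutator (FreeGroup A)}
  Symbol := (A × Bool) ⊕ Unit
  finite_symbol := inferInstance
  encode x := x.1.1.map Sum.inl ++ List.replicate x.1.2 (Sum.inr ())
  encode_injective := by
    rintro ⟨⟨g, k⟩, _⟩ ⟨⟨g', k'⟩, _⟩ h
    obtain ⟨h₁, h₂⟩ := map_inl_append_replicate_inj h
    simp_all
  size x := x.1.1.length + x.1.2
  Yes x := commutatorLength (FreeGroup.mk x.1.1) ≤ (x.1.2 : ℕ∞)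

end Problems

/-! A cyclic word is treated as a cyclic permutation (`List.formPerm`) of the positions of its
letters, and complexity is measured by the number of transpositions needed to write a permutation.

One interchange costs one commutator: `s x y t p` times the inverse of `s t y x p` is a conjugate of
`[x y, t x⁻¹]`. Hence k interchanges make `v w̃⁻¹` a product of k commutators for some rotation `w̃`
(`CbiReach.exists_isCommutatorProd`).

Conversely, let `v · t w⁻¹ t⁻¹` be a product of k commutators. Geometrically `v` and `w⁻¹` bound a
surface of genus k, thickened from a graph: the letters of the two boundary words, with cyclic
orders σ, are paired with inverse letters by an involution π, and the vertices are the cycles of σπ.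
So the number of transpositions in σπ bounds the genus. `HasPairing` records exactly this, and it is
carried along by algebra: it holds in genus 0 for `w` against `w⁻¹`; inserting or cancelling `a a⁻¹`
preserves the genus bound, while exchanging two adjacent blocks adds two transpositions, so that
prepending a commutator raises the bound by one. Starting from `w` one conjugates by `t`, prepends
the k commutators and reduces freely to `v`.

For positive `v`, `w` the pairing matches letters of `v` with letters of `w`, so `w` becomes a
second cyclic order W on the positions L of `v`. Removing the letters of `w⁻¹` from the cycles shows
that `L W⁻¹` is a product of at most 2k transpositions. Finally one interchange removes two of
these: the first transposition splits the cycle L, and since W is a single cycle there is a second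
one which joins the two pieces again (`cbiReach_of_isSwapProd`).

For the reduction, the inputs are `v w̃⁻¹` for all rotations `w̃`. The bound k is capped at `|v|`,
which always bounds the distance, because the size of a CBI input does not count k. -/

open Equiv

/-! ### Products of transpositions and splitting of cycles -/

section SwapProducts

variable {α : Type*} [DecidableEq α]

/-- `f` is a product of at most `j` transpositions. -/
def IsSwapProd : ℕ → Perm α → Prop
  | 0, f => f = 1
  | j + 1, f => IsSwapProd j f ∨ ∃ a b g, IsSwapProd j g ∧ f = swap a b * g

theorem IsSwapProd.swap_mul {j : ℕ} {f : Perm α} (h : IsSwapProd j f) (a b : α) :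
    IsSwapProd (j + 1) (swap a b * f) := .inr ⟨a, b, f, h, rfl⟩

theorem IsSwapProd.succ {j : ℕ} {f : Perm α} (h : IsSwapProd j f) : IsSwapProd (j + 1) f := .inl h

theorem isSwapProd_one : ∀ j, IsSwapProd j (1 : Perm α)
  | 0 => rfl
  | j + 1 => (isSwapProd_one j).succ

theorem IsSwapProd.mono {i j : ℕ} {f : Perm α} (h : IsSwapProd i f) (hij : i ≤ j) :
    IsSwapProd j f := by
  induction hij with
  | refl => exact h
  | step _ ih => exact ih.succ

/-- Multiplying by the transposition of a moved point and its image shortens a product of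
transpositions. -/
theorem IsSwapProd.swap_apply_mul : ∀ {j : ℕ} {f : Perm α} {a : α}, IsSwapProd (j + 1) f → f a ≠ a →
    IsSwapProd j (swap a (f a) * f)
  | 0, f, a, .inl h, hf => absurd (by simp [show f = 1 from h]) hf
  | _ + 1, _, _, .inl h, hf => (h.swap_apply_mul hf).succ
  | j, _, a, .inr ⟨c, d, g, hg, rfl⟩, hf => by
    by_cases hga : g a = a
    -- Since `g` fixes `a`, only the leading transposition moves `a`, and it is the one to be
    -- cancelled.
    · have : swap a ((swap c d * g) a) = swap c d := by
        rw [Perm.mul_apply, hga]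
        rw [Perm.mul_apply, hga] at hf
        rcases eq_or_ne a c with rfl | hc
        · simp
        · rcases eq_or_ne a d with rfl | hd
          · simp [swap_comm]
          · exact absurd (swap_apply_of_ne_of_ne hc hd) hf
      rw [this, ← mul_assoc, swap_mul_self, one_mul]
      exact hg
    · cases j with
      | zero => exact absurd (by simp [show g = 1 from hg]) hga
      | succ j =>
        -- Shorten `g` first, then move `swap a e` past `swap c d`. If `swap c d` fixes `a`, it
        -- carries `e` to the image of `a`; otherwise it moves `a`, hence fixes `e`, and it is
        -- itself conjugated.
        have ih := hg.swap_apply_mul hga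
        set e := g a with he
        rw [Perm.mul_apply, ← he] at hf ⊢
        by_cases h : swap c d a = a
        · refine .inr ⟨c, d, _, ih, ?_⟩
          have : swap c d * swap a e = swap a (swap c d e) * swap c d := by
            rw [mul_swap_eq_swap_mul, h]
          rw [← mul_assoc, ← mul_assoc, this]
        · have hb : swap c d e = e := by
            rcases eq_or_ne a c with rfl | hc
            · refine swap_apply_of_ne_of_ne hga ?_
              rintro hd
              exact hf (by rw [hd, swap_apply_right])
            · rcases eq_or_ne a d with rfl | hd
              · refine swap_apply_of_ne_of_ne ?_ hga
                rintro hd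
                exact hf (by rw [hd, swap_apply_left])
              · exact absurd (swap_apply_of_ne_of_ne hc hd) h
          rw [hb]
          refine .inr ⟨swap a e c, swap a e d, _, ih, ?_⟩
          rw [← mul_assoc, ← mul_assoc, mul_swap_eq_swap_mul]

theorem IsSwapProd.pos_of_apply_ne {j : ℕ} {f : Perm α} {a : α} (h : IsSwapProd j f)
    (ha : f a ≠ a) : ∃ i, j = i + 1 := by
  cases j with
  | zero => exact absurd (by simp [show f = 1 from h]) ha
  | succ i => exact ⟨i, rfl⟩

/-- A transposition of two points of one cycle splits it just before these points. Read backwards,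
it merges two cycles. -/
theorem swap_mul_formPerm_append {a b : α} {X Y : List α} (h : (a :: X ++ b :: Y).Nodup) :
    swap a b * (a :: X ++ b :: Y).formPerm = (a :: X).formPerm * (b :: Y).formPerm := by
  induction X generalizing a with
  | nil => simp [← mul_assoc]
  | cons c X ih =>
    have h' : (c :: X ++ b :: Y).Nodup := by
      simp only [List.cons_append, List.nodup_cons] at h ⊢; exact h.2
    have hne : a ≠ b ∧ c ≠ b ∧ a ≠ c:= by simp at h; grind
    have e := ih h'
    simp only [List.cons_append, List.formPerm_cons_cons] at e ⊢
    rw [mul_assoc (swap a c), ← e, ← mul_assoc, ← mul_assoc]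
    congr 1
    rw [swap_mul_eq_mul_swap, swap_inv, swap_apply_left, swap_apply_of_ne_of_ne]
    all_goals grind

end SwapProducts

/-! ### Sequences of interchanges up to rotation -/

section Reach

variable {A : Type*}

/-- `w` is reached from `v` by `k` cyclic block interchanges, up to cyclic permutation. -/
def CbiReach : ℕ → List A → List A → Prop
  | 0, v, w => v.IsRotated w
  | k + 1, v, w => ∃ z, IsCyclicBlockInterchange v z ∧ CbiReach k z w

theorem isCyclicBlockInterchange_of_isRotated {v w : List A} (h : v.IsRotated w) :
    IsCyclicBlockInterchange v w :=
  ⟨w, w, h, .refl _, w, [], [], [], by simp, by simp⟩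

theorem IsCyclicBlockInterchange.of_isRotated {v₁ v₂ w₁ w₂ : List A}
    (h : IsCyclicBlockInterchange v₁ w₁) (hv : v₂.IsRotated v₁) (hw : w₂.IsRotated w₁) :
    IsCyclicBlockInterchange v₂ w₂ := by
  obtain ⟨v', w', h₁, h₂, h₃⟩ := h
  exact ⟨v', w', hv.trans h₁, hw.trans h₂, h₃⟩

theorem IsCyclicBlockInterchange.map {B : Type*} (f : A → B) {v w : List A}
    (h : IsCyclicBlockInterchange v w) : IsCyclicBlockInterchange (v.map f) (w.map f) := by
  obtain ⟨v', w', h₁, h₂, a, b, c, d, rfl, rfl⟩ := h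
  exact ⟨_, _, h₁.map f, h₂.map f, a.map f, b.map f, c.map f, d.map f, by simp, by simp⟩

theorem CbiReach.map {B : Type*} (f : A → B) : ∀ {k : ℕ} {v w : List A}, CbiReach k v w →
    CbiReach k (v.map f) (w.map f)
  | 0, _, _, h => List.IsRotated.map h f
  | _ + 1, _, _, ⟨_, h, h'⟩ => ⟨_, h.map f, h'.map f⟩

theorem CbiReach.refl (v : List A) : ∀ k, CbiReach k v v
  | 0 => List.IsRotated.refl _
  | k + 1 => ⟨v, isCyclicBlockInterchange_of_isRotated (.refl _), CbiReach.refl v k⟩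

theorem CbiReach.of_isRotated_left {k : ℕ} {v v' w : List A} (hv : v.IsRotated v')
    (h : CbiReach k v' w) : CbiReach k v w := by
  cases k with
  | zero => exact hv.trans h
  | succ k =>
    obtain ⟨z, h, h'⟩ := h
    exact ⟨z, h.of_isRotated hv (.refl _), h'⟩

theorem CbiReach.succ : ∀ {k : ℕ} {v w : List A}, CbiReach k v w → CbiReach (k + 1) v w
  | 0, _, _, h => ⟨_, isCyclicBlockInterchange_of_isRotated h, .refl _ 0⟩
  | _ + 1, _, _, ⟨z, h, h'⟩ => ⟨z, h, h'.succ⟩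

theorem CbiReach.mono {j k : ℕ} {v w : List A} (h : CbiReach j v w) (hjk : j ≤ k) :
    CbiReach k v w := by
  induction hjk with
  | refl => exact h
  | step _ ih => exact ih.succ

theorem cbiReach_of_chain {z : ℕ → List A} : ∀ {k : ℕ},
    (∀ i < k, IsCyclicBlockInterchange (z i) (z (i + 1))) → CbiReach k (z 0) (z k) := by
  intro k
  induction k generalizing z with
  | zero => exact fun _ => .refl _ 0
  | succ k ih =>
    intro h
    exact ⟨z 1, h 0 (by omega), ih (z := fun i => z (i + 1)) fun i hi => h (i + 1) (by omega)⟩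

theorem CbiReach.exists_chain : ∀ {k : ℕ} {v w : List A}, CbiReach (k + 1) v w →
    ∃ z : ℕ → List A, z 0 = v ∧ z (k + 1) = w ∧
      ∀ i < k + 1, IsCyclicBlockInterchange (z i) (z (i + 1)) := by
  intro k
  induction k with
  | zero =>
    rintro v w ⟨z, h, h'⟩
    refine ⟨fun i => if i = 0 then v else w, by simp, by simp, fun i hi => ?_⟩
    obtain rfl : i = 0 := by omega
    simpa using h.of_isRotated (.refl _) (List.IsRotated.symm h')
  | succ k ih =>
    rintro v w ⟨z, h, h'⟩
    obtain ⟨y, h₀, h₁, hy⟩ := ih h'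
    refine ⟨fun i => if i = 0 then v else y (i - 1), by simp, by simpa using h₁, fun i hi => ?_⟩
    rcases i with _ | i
    · simpa [h₀] using h
    · simpa using hy i (by omega)

/-- A rotation is itself an interchange, so exactly k and at most k steps amount to the same. For k
> 0 the final rotation is absorbed into the last interchange; for k = 0 it is the special case of
the definition. -/
theorem cbiDist_le_iff {v w : List A} {k : ℕ} : cbiDist v w ≤ k ↔ CbiReach k v w := by
  unfold cbiDist
  split_ifs with hr
  · simpa using CbiReach.mono (j := 0) hr (Nat.zero_le k)
  constructor
  · intro h
    have : (⨅ k ∈ {k : ℕ | ∃ z : ℕ → List A, z 0 = v ∧ z k = w ∧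
      ∀ i < k, IsCyclicBlockInterchange (z i) (z (i + 1))}, (k : ℕ∞)) < ((k + 1 : ℕ) : ℕ∞) :=
      lt_of_le_of_lt h (by exact_mod_cast Nat.lt_succ_self k)
    simp only [iInf_lt_iff] at this
    obtain ⟨j, ⟨z, rfl, rfl, hz⟩, hj⟩ := this
    exact (cbiReach_of_chain hz).mono (by have : j < k + 1 := by exact_mod_cast hj
                                          omega)
  · intro h
    cases k with
    | zero => exact absurd h hr
    | succ k => exact iInf₂_le (k + 1) h.exists_chain

end Reach

/-! ### Sorting a cyclic order by block interchanges -/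

section Sorting

variable {α : Type*} [DecidableEq α]

/-- A cyclic order leaves every set that contains some, but not all, of its points. -/
theorem exists_formPerm_leaves {W : List α} (hW : W.Nodup) {p : α → Prop} {a b : α} (ha : a ∈ W)
    (hb : b ∈ W) (hpa : p a) (hpb : ¬ p b) : ∃ c ∈ W, p c ∧ ¬ p (W.formPerm c) := by
  by_contra! hcon
  obtain ⟨i, hi, rfl⟩ := List.getElem_of_mem ha
  obtain ⟨j, hj, rfl⟩ := List.getElem_of_mem hb
  have key : ∀ n, p ((W.formPerm ^ n) W[i]) ∧ (W.formPerm ^ n) W[i] ∈ W := by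
    intro n
    induction n with
    | zero => simpa using hpa
    | succ n ih =>
      rw [pow_succ', Perm.mul_apply]
      exact ⟨hcon _ ih.2 ih.1, List.formPerm_apply_mem_of_mem ih.2⟩
  -- This power of the cycle carries position `i` to position `j` modulo the length; adding the
  -- length avoids truncated subtraction.
  have := (key (j + W.length - i)).1
  rw [List.formPerm_pow_apply_getElem _ hW] at this
  apply hpb
  convert this using 2
  rw [show i + (j + W.length - i) = j + W.length by omega, Nat.add_mod_right, Nat.mod_eq_of_lt hj]

/-- Sorting by block interchanges. -/
theorem cbiReach_of_isSwapProd {k : ℕ} {L W : List α} (hL : L.Nodup) (hLW : L.Perm W)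
    (h : IsSwapProd (2 * k) (L.formPerm * W.formPerm⁻¹)) : CbiReach k L W := by
  have hW : W.Nodup := hLW.nodup_iff.1 hL
  induction k generalizing L with
  | zero =>
    have h : L.formPerm * W.formPerm⁻¹ = 1 := h
    rw [mul_inv_eq_one, List.formPerm_eq_formPerm_iff hL hW] at h
    rcases h with h | ⟨h₁, h₂⟩
    · exact h
    · match L, h₁ with
      | [], _ => rw [List.nil_perm.1 hLW]; exact .refl _ 0
      | [x], _ => rw [List.singleton_perm.1 hLW]; exact .refl _ 0
  | succ k ih =>
    by_cases h1 : L.formPerm * W.formPerm⁻¹ = 1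
    · exact (ih hL hLW (h1 ▸ isSwapProd_one _)).succ
    set ρ := L.formPerm * W.formPerm⁻¹ with hρ
    obtain ⟨a, ha⟩ : ∃ a, ρ a ≠ a := by
      by_contra! hc
      exact h1 (Perm.ext hc)
    have hρL : ∀ {x}, x ∉ L → ρ x = x := fun {x} hx => by
      rw [hρ, Perm.mul_apply, Perm.inv_eq_iff_eq.2 (List.formPerm_apply_of_notMem
        (fun h => hx (hLW.mem_iff.2 h))).symm, List.formPerm_apply_of_notMem hx]
    have haL : a ∈ L := by_contra fun h => ha (hρL h)
    have hbL : ρ a ∈ L := by_contra fun h => ha (ρ.injective (hρL h))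
    -- First transposition saved: `swap a b` splits the cycle of L into `a :: X` and `b :: Y`.
    have hs := IsSwapProd.swap_apply_mul (j := 2 * k + 1) h ha
    set b := ρ a with hb
    obtain ⟨P, Q, rfl⟩ := List.append_of_mem haL
    have hrot : (P ++ a :: Q).IsRotated (a :: (Q ++ P)) := by
      simpa using List.isRotated_append (l := P) (l' := a :: Q)
    have hbQP : b ∈ Q ++ P := by
      have := hrot.mem_iff.1 hbL
      simpa [ha] using this
    obtain ⟨X, Y, hXY⟩ := List.append_of_mem hbQP
    rw [hXY] at hrot
    generalize hLdef : P ++ a :: Q = L at *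
    have hnd : (a :: X ++ b :: Y).Nodup := hrot.nodup_iff.1 hL
    have e₁ : swap a b * ρ * W.formPerm = (a :: X).formPerm * (b :: Y).formPerm := by
      rw [hρ, List.formPerm_eq_of_isRotated hL hrot, mul_assoc, inv_mul_cancel_right,
        ← swap_mul_formPerm_append hnd]
      rfl
    set ρ' := swap a b * ρ with hρ'
    have hmem : ∀ x, x ∈ W ↔ x ∈ a :: X ∨ x ∈ b :: Y := fun x => by
      rw [← hLW.mem_iff, hrot.mem_iff, ← List.cons_append, List.mem_append]
    have hdisj : ∀ {x}, x ∈ a :: X → x ∈ b :: Y → False := fun h h' =>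
      List.disjoint_of_nodup_append hnd h h'
    -- As W is one cycle, it must step from `a :: X` into `b :: Y`. At that step `ρ'` sends `d` back
    -- into `a :: X`, so `swap c d` saves a second transposition and joins the two cycles.
    obtain ⟨c₀, hc₀W, hc₀, hd₀⟩ := exists_formPerm_leaves hW (p := (· ∈ a :: X)) (a := a) (b := b)
      ((hmem a).2 (by simp)) ((hmem b).2 (by simp)) (by simp) fun h => hdisj h (by simp)
    set d := W.formPerm c₀ with hd
    have hd' : d ∈ b :: Y := ((hmem d).1 (List.formPerm_apply_mem_of_mem hc₀W)).resolve_left hd₀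
    have hc' : ρ' d ∈ a :: X := by
      have := congrArg (· c₀) e₁
      simp only [Perm.mul_apply] at this
      rw [← hd, List.formPerm_apply_of_notMem (fun h => hdisj hc₀ h)] at this
      rw [this]
      exact List.formPerm_apply_mem_of_mem hc₀
    set c := ρ' d with hc
    have hcd : c ≠ d := fun h => hdisj (h ▸ hc') hd'
    have hs' := IsSwapProd.swap_apply_mul (j := 2 * k) hs (a := d) hcd
    rw [← hc] at hs'
    obtain ⟨X₁, X₂, hX⟩ := List.append_of_mem hc'
    obtain ⟨Y₁, Y₂, hY⟩ := List.append_of_mem hd'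
    have hXnd : (a :: X).Nodup := (List.nodup_append.1 hnd).1
    have hYnd : (b :: Y).Nodup := (List.nodup_append.1 hnd).2.1
    have hperm : (a :: X ++ b :: Y).Perm (d :: (Y₂ ++ Y₁) ++ c :: (X₂ ++ X₁)) := by
      rw [hX, hY]
      refine List.perm_append_comm.trans (.append ?_ ?_)
      · simpa using List.perm_append_comm (l₁ := Y₁) (l₂ := d :: Y₂)
      · simpa using List.perm_append_comm (l₁ := X₁) (l₂ := c :: X₂)
    have hnd' := hperm.nodup_iff.1 hnd
    -- The joined cycle is, up to rotation, `X₁ d Y₂ Y₁ c X₂`, whereas L was `X₁ c X₂ Y₁ d Y₂`: the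
    -- blocks `c X₂` and `d Y₂` are interchanged.
    refine ⟨d :: (Y₂ ++ Y₁) ++ c :: (X₂ ++ X₁), ?_,
      ih hnd' (hperm.symm.trans (hrot.perm.symm.trans hLW)) ?_⟩
    · refine ⟨a :: X ++ b :: Y, X₁ ++ (d :: Y₂) ++ Y₁ ++ (c :: X₂), hrot, ?_,
        X₁, c :: X₂, Y₁, d :: Y₂, by rw [hX, hY]; simp, by simp⟩
      have := List.isRotated_append (l := d :: (Y₂ ++ Y₁) ++ c :: X₂) (l' := X₁)
      simpa using this
    · convert hs' using 1
      have hX' : (a :: X).formPerm = (c :: (X₂ ++ X₁)).formPerm :=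
        List.formPerm_eq_of_isRotated hXnd
          (by rw [hX]; exact List.isRotated_append (l := X₁) (l' := c :: X₂))
      have hY' : (b :: Y).formPerm = (d :: (Y₂ ++ Y₁)).formPerm :=
        List.formPerm_eq_of_isRotated hYnd
          (by rw [hY]; exact List.isRotated_append (l := Y₁) (l' := d :: Y₂))
      rw [mul_inv_eq_iff_eq_mul, mul_assoc, e₁, ← mul_right_inj (swap d c), ← mul_assoc (swap d c),
        swap_mul_self, one_mul, swap_mul_formPerm_append hnd', ← hX', ← hY']
      · refine Perm.Disjoint.commute fun x => ?_
        by_cases hx : x ∈ b :: Y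
        · exact .inr (List.formPerm_apply_of_notMem fun h => hdisj h hx)
        · exact .inl (List.formPerm_apply_of_notMem hx)

end Sorting

/-! ### Effect of word operations on the transposition count -/

section SwapProducts

variable {α : Type*} [DecidableEq α]

/-- One transposition cuts R off from the cycle formed by B and C, which is also the cycle of C
followed by B; another glues R back at the other place. If a block is empty, the cyclic word does
not change. -/
theorem formPerm_swap_blocks {R B C : List α} (h : (R ++ B ++ C).Nodup) :
    (R ++ C ++ B).formPerm = (R ++ B ++ C).formPerm ∨
      ∃ a b c d, (R ++ C ++ B).formPerm = swap a b * (swap c d * (R ++ B ++ C).formPerm) := by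
  match R, B, C with
  | [], B, C => exact .inl (List.formPerm_eq_of_isRotated h List.isRotated_append).symm
  | R, [], C => exact .inl (by simp)
  | R, B, [] => exact .inl (by simp)
  | r :: R, b :: B, c :: C =>
    have hp : (r :: R ++ b :: B ++ c :: C).Perm (r :: R ++ c :: C ++ b :: B) := by
      rw [List.append_assoc, List.append_assoc]
      exact List.perm_append_comm.append_left _
    have h' := hp.nodup_iff.1 h
    refine .inr ⟨r, c, r, b, ?_⟩
    rw [← mul_right_inj (swap r c), ← mul_assoc (swap r c) (swap r c), swap_mul_self, one_mul]
    simp only [List.append_assoc, List.cons_append] at h h' ⊢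
    have e₁ := swap_mul_formPerm_append (X := R) (Y := B ++ c :: C) h
    have e₂ := swap_mul_formPerm_append (X := R) (Y := C ++ b :: B) h'
    simp only [List.cons_append] at e₁ e₂
    rw [e₁, e₂]
    congr 1
    refine List.formPerm_eq_of_isRotated ?_ (List.isRotated_append (l := c :: C) (l' := b :: B))
    exact (List.nodup_append.1 (show (r :: R ++ (c :: C ++ b :: B)).Nodup from h')).2.1

theorem swap_mul_swap_mul_mul_swap_mul {σ π : Perm α} {x y q : α} (hσx : σ x = x) (hσy : σ y = y)
    (hxy : x ≠ y) (hxq : x ≠ q) (hyq : y ≠ q) :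
    swap x y * swap y q * σ * (swap x y * π) = swap x q * (σ * π) := by
  have h : σ * swap x y = swap x y * σ := by rw [mul_swap_eq_swap_mul, hσx, hσy]
  rw [mul_assoc _ σ, ← mul_assoc σ, h]
  ext z
  simp only [Perm.mul_apply]
  generalize σ (π z) = z
  simp only [swap_apply_def]
  grind

/-- Used to cancel adjacent letters `x`, `y` whose partners `x'`, `y'` lie elsewhere: the partners
get paired with each other, and one transposition is saved. Pushing all transpositions to the left
of `θ = σ π` turns this into a computation with `x`, `y`, `q` and the images `s`, `r` of the
partners. -/
theorem IsSwapProd.of_cancel {j : ℕ} {σ π : Perm α} {x y q x' y' : α}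
    (h : IsSwapProd j (swap x y * swap y q * σ * (swap x x' * (swap y y' * π))))
    (hσx : σ x = x) (hσy : σ y = y) (hπx : π x = x) (hπy : π y = y) (hxy : x ≠ y)
    (hqx : q ≠ x) (hqy : q ≠ y) (hx'x : x' ≠ x) (hx'y : x' ≠ y) (hy'x : y' ≠ x) (hy'y : y' ≠ y)
    (hx'y' : x' ≠ y') : ∃ i, j = i + 1 ∧ IsSwapProd i (σ * (swap x' y' * π)) := by
  set s := σ x' with hs
  set r := σ y' with hr
  have hsx : s ≠ x := fun h => hx'x (σ.injective (by rw [← hs, h, hσx]))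
  have hsy : s ≠ y := fun h => hx'y (σ.injective (by rw [← hs, h, hσy]))
  have hrx : r ≠ x := fun h => hy'x (σ.injective (by rw [← hr, h, hσx]))
  have hry : r ≠ y := fun h => hy'y (σ.injective (by rw [← hr, h, hσy]))
  have hsr : s ≠ r := fun h => hx'y' (σ.injective h)
  set θ := σ * π with hθ
  have hθx : θ x = x := by simp [hθ, hπx, hσx]
  have hθy : θ y = y := by simp [hθ, hπy, hσy]
  have e : swap x y * swap y q * σ * (swap x x' * (swap y y' * π)) =
      swap x y * (swap y q * (swap x s * (swap y r * θ))) := by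
    have h₁ : σ * swap x x' = swap x s * σ := by rw [mul_swap_eq_swap_mul, hσx]
    have h₂ : σ * swap y y' = swap y r * σ := by rw [mul_swap_eq_swap_mul, hσy]
    rw [hθ, mul_assoc (swap x y * swap y q), ← mul_assoc σ, h₁, mul_assoc (swap x s), ← mul_assoc σ,
      h₂]
    simp only [mul_assoc]
  have e' : σ * (swap x' y' * π) = swap s r * θ := by
    rw [← mul_assoc, mul_swap_eq_swap_mul, ← hs, ← hr, mul_assoc]
  rw [e] at h
  rw [e']
  clear_value s r θ
  clear e e' hs hr
  by_cases hqs : q = s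
  · subst hqs
    have e₁ : swap x y * (swap y q * (swap x q * (swap y r * θ))) =
        swap y q * (swap y r * θ) := by
      ext z
      simp only [Perm.mul_apply]
      generalize θ z = z
      simp only [swap_apply_def]
      grind
    rw [e₁] at h
    have hy : (swap y q * (swap y r * θ)) y = r := by
      simp only [Perm.mul_apply, hθy, swap_apply_left]
      exact swap_apply_of_ne_of_ne hry hsr.symm
    obtain ⟨i, rfl⟩ := h.pos_of_apply_ne (a := y) (by rwa [hy])
    refine ⟨i, rfl, ?_⟩
    have := h.swap_apply_mul (a := y) (by rwa [hy])
    rw [hy] at this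
    convert this using 1
    ext z
    simp only [Perm.mul_apply]
    generalize θ z = z
    simp only [swap_apply_def]
    split_ifs <;> simp_all
  -- Here both `x` and `y` split off and leave `θ`, saving two transpositions; the target `swap s r
  -- * θ` costs one of them.
  by_cases hqr : q = r
  · subst hqr
    have e₁ : swap x y * (swap y q * (swap x s * (swap y q * θ))) = swap x y * (swap x s * θ) := by
      ext z
      simp only [Perm.mul_apply]
      generalize θ z = z
      simp only [swap_apply_def]
      grind
    rw [e₁] at h
    have hy : (swap x y * (swap x s * θ)) y = x := by
      simp only [Perm.mul_apply, hθy]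
      rw [swap_apply_of_ne_of_ne hxy.symm hsy.symm, swap_apply_right]
    obtain ⟨i, rfl⟩ := h.pos_of_apply_ne (a := y) (by rwa [hy])
    have h₁ := h.swap_apply_mul (a := y) (by rwa [hy])
    rw [hy, swap_comm y x, ← mul_assoc, swap_mul_self, one_mul] at h₁
    have hx : (swap x s * θ) x = s := by simp [hθx]
    obtain ⟨i, rfl⟩ := h₁.pos_of_apply_ne (a := x) (by rwa [hx])
    have h₂ := h₁.swap_apply_mul (a := x) (by rwa [hx])
    rw [hx, ← mul_assoc, swap_mul_self, one_mul] at h₂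
    exact ⟨_, rfl, h₂.swap_mul _ _⟩
  -- In the generic case splitting off `y` and `x` again saves two, and one is spent on cancelling
  -- `swap s q`.
  · have e₁ : swap x y * (swap y q * (swap x s * (swap y r * θ))) =
        swap y r * (swap x s * (swap s q * (swap s r * θ))) := by
      ext z
      simp only [Perm.mul_apply]
      generalize θ z = z
      simp only [swap_apply_def]
      grind
    rw [e₁] at h
    have hy : (swap y r * (swap x s * (swap s q * (swap s r * θ)))) y = r := by
      simp only [Perm.mul_apply, hθy, swap_apply_def]
      grind
    obtain ⟨i, rfl⟩ := h.pos_of_apply_ne (a := y) (by rwa [hy])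
    have h₁ := h.swap_apply_mul (a := y) (by rwa [hy])
    rw [hy, ← mul_assoc, swap_mul_self, one_mul] at h₁
    have hx : (swap x s * (swap s q * (swap s r * θ))) x = s := by
      simp only [Perm.mul_apply, hθx, swap_apply_def]
      grind
    obtain ⟨i, rfl⟩ := h₁.pos_of_apply_ne (a := x) (by rwa [hx])
    have h₂ := h₁.swap_apply_mul (a := x) (by rwa [hx])
    rw [hx, ← mul_assoc, swap_mul_self, one_mul] at h₂
    refine ⟨_, rfl, ?_⟩
    have := h₂.swap_mul s q
    rwa [← mul_assoc, swap_mul_self, one_mul] at this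

end SwapProducts

/-! ### Pairings of inverse letters: insertion, deletion, block exchange -/

section Pairings

variable {A : Type*}

/-- The inverse of a letter of `A ∪ A⁻¹`. -/
def letterInv (p : A × Bool) : A × Bool := (p.1, !p.2)

@[simp] theorem letterInv_letterInv (p : A × Bool) : letterInv (letterInv p) = p := by
  simp [letterInv]

theorem letterInv_ne (p : A × Bool) : letterInv p ≠ p := by
  rcases p with ⟨a, _ | _⟩ <;> simp [letterInv]

/-- `π` pairs the letters of the cyclic words `X` and `Y` with inverse letters; the positions of the
letters are the entries of `L` and `M`, and `l` gives the letter at a position. -/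
structure IsPairing (X Y : List (A × Bool)) (L M : List ℕ) (l : ℕ → A × Bool) (π : Perm ℕ) :
    Prop where
  nodup : (L ++ M).Nodup
  invol : ∀ z, π (π z) = z
  fix : ∀ z, z ∉ L → z ∉ M → π z = z
  label : ∀ z, z ∈ L ∨ z ∈ M → l (π z) = letterInv (l z)
  map_left : L.map l = X
  map_right : M.map l = Y

/-- The cyclic words `X` and `Y` admit a pairing of their letters for which the surface obtained by
gluing an annulus along it has genus at most `m / 2`. -/
def HasPairing (Y : List (A × Bool)) (m : ℕ) (X : List (A × Bool)) : Prop :=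
  ∃ L M l π j, IsPairing X Y L M l π ∧ IsSwapProd j (L.formPerm * M.formPerm * π) ∧
    2 * j ≤ X.length + Y.length + 2 * m

variable {X Y : List (A × Bool)} {L M : List ℕ} {l : ℕ → A × Bool} {π : Perm ℕ} {m : ℕ}

theorem IsPairing.ne (h : IsPairing X Y L M l π) {z : ℕ} (hz : z ∈ L ∨ z ∈ M) : π z ≠ z :=
  fun e => letterInv_ne (l z) (by rw [← h.label z hz, e])

theorem IsPairing.mem (h : IsPairing X Y L M l π) {z : ℕ} (hz : z ∈ L ∨ z ∈ M) :
    π z ∈ L ∨ π z ∈ M := by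
  by_contra! hc
  exact h.ne hz (π.injective (h.fix _ hc.1 hc.2))

theorem HasPairing.append_comm {P Q : List (A × Bool)} (h : HasPairing Y m (P ++ Q)) :
    HasPairing Y m (Q ++ P) := by
  obtain ⟨L, M, l, π, j, hp, hs, hj⟩ := h
  obtain ⟨L₁, L₂, rfl, h₁, h₂⟩ := List.map_eq_append_iff.1 hp.map_left
  have hn : (L₁ ++ L₂).Nodup := (List.nodup_append.1 hp.nodup).1
  refine ⟨L₂ ++ L₁, M, l, π, j, ⟨?_, hp.invol, ?_, ?_, by simp [h₁, h₂], hp.map_right⟩, ?_, ?_⟩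
  · exact (List.perm_append_comm.append_right M).nodup_iff.1 hp.nodup
  · exact fun z hz hz' => hp.fix z (fun h => hz (by simpa [or_comm] using h)) hz'
  · exact fun z hz => hp.label z (by simpa [or_comm] using hz)
  · rwa [List.formPerm_eq_of_isRotated hn List.isRotated_append] at hs
  · simpa [Nat.add_comm P.length] using hj

theorem HasPairing.swap_blocks {P B C : List (A × Bool)} (h : HasPairing Y m (P ++ B ++ C)) :
    HasPairing Y (m + 2) (P ++ C ++ B) := by
  obtain ⟨L, M, l, π, j, hp, hs, hj⟩ := h
  obtain ⟨L', L₃, rfl, h', h₃⟩ := List.map_eq_append_iff.1 hp.map_left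
  obtain ⟨L₁, L₂, rfl, h₁, h₂⟩ := List.map_eq_append_iff.1 h'
  have hn : (L₁ ++ L₂ ++ L₃).Nodup := (List.nodup_append.1 hp.nodup).1
  have hperm : (L₁ ++ L₂ ++ L₃).Perm (L₁ ++ L₃ ++ L₂) := by
    rw [List.append_assoc, List.append_assoc]
    exact List.perm_append_comm.append_left _
  have hs' : IsSwapProd (j + 2) ((L₁ ++ L₃ ++ L₂).formPerm * M.formPerm * π) := by
    rcases formPerm_swap_blocks hn with e | ⟨a, b, c, d, e⟩
    · rw [e]; exact hs.mono (by omega)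
    · rw [e]
      simpa only [mul_assoc] using (hs.swap_mul c d).swap_mul a b
  refine ⟨L₁ ++ L₃ ++ L₂, M, l, π, j + 2, ⟨?_, hp.invol, ?_, ?_, by simp [h₁, h₂, h₃],
    hp.map_right⟩, hs', ?_⟩
  · exact (hperm.append_right M).nodup_iff.1 hp.nodup
  · exact fun z hz hz' => hp.fix z (fun h => hz (hperm.mem_iff.1 h)) hz'
  · exact fun z hz => hp.label z (hz.imp_left hperm.mem_iff.2)
  · simp only [List.length_append] at hj ⊢
    omega

/-- Two new points paired with each other multiply the permutation by `swap x q`, where `q` is the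
next point. One transposition for two letters leaves the bound unchanged. -/
theorem HasPairing.insert {X : List (A × Bool)} (h : HasPairing Y m X) (hX : X ≠ [])
    (a : A × Bool) : HasPairing Y m (a :: letterInv a :: X) := by
  obtain ⟨L, M, l, π, j, hp, hs, hj⟩ := h
  match L, hp with
  | [], hp => exact absurd hp.map_left.symm hX
  | q :: R, hp =>
  obtain ⟨x, hx⟩ := Infinite.exists_notMem_finset ((q :: R ++ M).toFinset)
  obtain ⟨y, hy⟩ := Infinite.exists_notMem_finset ((x :: (q :: R ++ M)).toFinset)
  simp only [List.cons_append, List.mem_toFinset, List.mem_cons, List.mem_append, not_or] at hx hy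
  have hxfix : π x = x := hp.fix x (by simp; tauto) (by tauto)
  have hyfix : π y = y := hp.fix y (by simp; tauto) (by tauto)
  have hσx : (q :: R).formPerm (M.formPerm x) = x := by
    rw [List.formPerm_apply_of_notMem hx.2.2, List.formPerm_apply_of_notMem (by simp; tauto)]
  have hσy : (q :: R).formPerm (M.formPerm y) = y := by
    rw [List.formPerm_apply_of_notMem hy.2.2.2, List.formPerm_apply_of_notMem (by simp; tauto)]
  have hne : ∀ {z}, z ≠ x → z ≠ y → π z ≠ x ∧ π z ≠ y := fun {z} h₁ h₂ =>
    ⟨fun h => h₁ (π.injective (h.trans hxfix.symm)), fun h => h₂ (π.injective (h.trans hyfix.symm))⟩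
  have hπx : (swap x y * π) x = y := by simp [hxfix]
  have hπy : (swap x y * π) y = x := by simp [hyfix]
  have hπ : ∀ {z}, z ≠ x → z ≠ y → (swap x y * π) z = π z := fun h₁ h₂ => by
    rw [Perm.mul_apply, swap_apply_of_ne_of_ne (hne h₁ h₂).1 (hne h₁ h₂).2]
  have hl : ∀ {z}, z ≠ x → z ≠ y →
      Function.update (Function.update l x a) y (letterInv a) z = l z := fun h₁ h₂ => by
    simp [h₁, h₂]
  have hlx : Function.update (Function.update l x a) y (letterInv a) x = a := by
    simp [Ne.symm hy.1]
  have hly : Function.update (Function.update l x a) y (letterInv a) y = letterInv a := by simp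
  refine ⟨x :: y :: q :: R, M, Function.update (Function.update l x a) y (letterInv a),
    swap x y * π, j + 1, ⟨?_, fun z => ?_, fun z hz hz' => ?_, fun z hz => ?_, ?_, ?_⟩, ?_, ?_⟩
  · have := hp.nodup
    simp only [List.cons_append, List.nodup_cons, List.mem_cons, List.mem_append] at this ⊢
    tauto
  · by_cases h₁ : z = x
    · rw [h₁, hπx, hπy]
    by_cases h₂ : z = y
    · rw [h₂, hπy, hπx]
    rw [hπ h₁ h₂, hπ (hne h₁ h₂).1 (hne h₁ h₂).2, hp.invol]
  · simp only [List.mem_cons, not_or] at hz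
    rw [hπ hz.1 hz.2.1, hp.fix z (by simp; tauto) hz']
  · by_cases h₁ : z = x
    · rw [h₁, hπx, hlx, hly]
    by_cases h₂ : z = y
    · rw [h₂, hπy, hlx, hly, letterInv_letterInv]
    rw [hπ h₁ h₂, hl (hne h₁ h₂).1 (hne h₁ h₂).2, hl h₁ h₂]
    exact hp.label z (by simpa [h₁, h₂] using hz)
  · rw [List.map_cons, List.map_cons, hlx, hly, ← hp.map_left]
    refine congrArg _ (congrArg _ (List.map_congr_left fun z hz => hl ?_ ?_))
    all_goals rintro rfl; simp at hz; tauto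
  · rw [← hp.map_right]
    refine List.map_congr_left fun z hz => hl ?_ ?_
    all_goals rintro rfl; tauto
  · have e : (x :: y :: q :: R).formPerm * M.formPerm * (swap x y * π) =
        swap x q * ((q :: R).formPerm * M.formPerm * π) := by
      rw [← swap_mul_swap_mul_mul_swap_mul (σ := (q :: R).formPerm * M.formPerm) (π := π) (y := y)
        (by simpa using hσx) (by simpa using hσy) (Ne.symm hy.1) (by tauto) (by tauto),
        List.formPerm_cons_cons, List.formPerm_cons_cons]
      simp only [mul_assoc]
    rw [e]
    exact hs.swap_mul _ _
  · simp only [List.length_cons]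
    omega

/-- Either the two letters are paired with each other and split off together, or their partners
carry mutually inverse letters and can be paired instead. In both cases one transposition is saved.
A third letter `q` must remain, hence the nonemptiness hypothesis. -/
theorem HasPairing.delete {X : List (A × Bool)} {a : A × Bool} (hX : X ≠ [])
    (h : HasPairing Y m (a :: letterInv a :: X)) : HasPairing Y m X := by
  obtain ⟨L, M, l, π, j, hp, hs, hj⟩ := h
  match L, hp with
  | [], hp => exact absurd hp.map_left (by simp)
  | [x], hp => exact absurd hp.map_left (by simp)
  | [x, y], hp => exact absurd hp.map_left (by simp [Ne.symm hX])
  | x :: y :: q :: R, hp =>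
  have hlx : l x = a := by have := hp.map_left; simp at this; tauto
  have hly : l y = letterInv a := by have := hp.map_left; simp at this; tauto
  have hlX : (q :: R).map l = X := by have := hp.map_left; simp at this; simp; tauto
  have hnd := hp.nodup
  simp only [List.cons_append, List.nodup_cons, List.mem_cons, List.mem_append, not_or] at hnd
  obtain ⟨⟨hxy, hxq, hxR, hxM⟩, ⟨hyq, hyR, hyM⟩, hnd'⟩ := hnd
  have hσx : ((q :: R).formPerm * M.formPerm) x = x := by
    rw [Perm.mul_apply, List.formPerm_apply_of_notMem hxM,
      List.formPerm_apply_of_notMem (by simp; tauto)]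
  have hσy : ((q :: R).formPerm * M.formPerm) y = y := by
    rw [Perm.mul_apply, List.formPerm_apply_of_notMem hyM,
      List.formPerm_apply_of_notMem (by simp; tauto)]
  have hσ : (x :: y :: q :: R).formPerm * M.formPerm =
      swap x y * swap y q * ((q :: R).formPerm * M.formPerm) := by
    rw [List.formPerm_cons_cons, List.formPerm_cons_cons]; simp only [mul_assoc]
  rw [hσ] at hs
  set σ := (q :: R).formPerm * M.formPerm with hσdef
  have key : ∀ {π' : Perm ℕ} {i}, π' x = x → π' y = y → (∀ z, π' (π' z) = z) →
      (∀ z, z ≠ x → z ≠ y → π z = z → π' z = z) →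
      (∀ z, z ≠ x → z ≠ y → z ∈ q :: R ∨ z ∈ M → l (π' z) = letterInv (l z)) →
      j = i + 1 → IsSwapProd i (σ * π') → HasPairing Y m X := by
    intro π' i h₁ h₂ h₃ h₄ h₅ hji h₆
    refine ⟨q :: R, M, l, π', i, ⟨?_, h₃, fun z hz hz' => ?_, fun z hz => ?_, hlX, hp.map_right⟩,
      h₆, ?_⟩
    · simpa using hnd'
    · by_cases hzx : z = x
      · rwa [hzx]
      by_cases hzy : z = y
      · rwa [hzy]
      exact h₄ z hzx hzy (hp.fix z (by simp at hz ⊢; tauto) hz')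
    · refine h₅ z ?_ ?_ hz
      all_goals rintro rfl; simp at hz; tauto
    · simp only [List.length_cons] at hj
      omega
  -- If the cancelling letters are partners, this undoes an insertion.
  by_cases hxy' : π x = y
  · have hyx : π y = x := by rw [← hxy', hp.invol]
    have hne : ∀ {z}, z ≠ x → z ≠ y → π z ≠ x ∧ π z ≠ y := fun {z} h₁ h₂ =>
      ⟨fun h => h₂ (π.injective (h.trans hyx.symm)), fun h => h₁ (π.injective (h.trans hxy'.symm))⟩
    have hπx : (swap x y * π) x = x := by simp [hxy']
    have hπy : (swap x y * π) y = y := by simp [hyx]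
    have hπ : ∀ {z}, z ≠ x → z ≠ y → (swap x y * π) z = π z := fun h₁ h₂ => by
      rw [Perm.mul_apply, swap_apply_of_ne_of_ne (hne h₁ h₂).1 (hne h₁ h₂).2]
    have e : swap x y * swap y q * σ * π = swap x q * (σ * (swap x y * π)) := by
      rw [← swap_mul_swap_mul_mul_swap_mul hσx hσy hxy hxq hyq, ← mul_assoc (swap x y) (swap x y),
        swap_mul_self, one_mul]
    have hφ : (swap x y * swap y q * σ * π) x = q := by
      rw [e]; simp [hxy', hσx]
    obtain ⟨i, rfl⟩ := hs.pos_of_apply_ne (a := x) (by rw [hφ]; tauto)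
    have hs' := hs.swap_apply_mul (a := x) (by rw [hφ]; tauto)
    rw [hφ, e, ← mul_assoc, swap_mul_self, one_mul] at hs'
    refine key hπx hπy (fun z => ?_) (fun z h₁ h₂ hz => by rwa [hπ h₁ h₂])
      (fun z h₁ h₂ hz => ?_) rfl hs'
    · by_cases h₁ : z = x
      · rw [h₁, hπx, hπx]
      by_cases h₂ : z = y
      · rw [h₂, hπy, hπy]
      rw [hπ h₁ h₂, hπ (hne h₁ h₂).1 (hne h₁ h₂).2, hp.invol]
    · rw [hπ h₁ h₂]
      exact hp.label z (by simp at hz ⊢; tauto)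
  · have hx' := hp.ne (z := x) (by simp)
    have hy' := hp.ne (z := y) (by simp)
    have hlx' := hp.label x (by simp)
    have hly' := hp.label y (by simp)
    have hix := hp.invol x
    have hiy := hp.invol y
    set x' := π x with hx'def
    set y' := π y with hy'def
    have hyx' : y' ≠ x := fun h => hxy' (by rw [hx'def, ← h, hiy])
    have hx'y' : x' ≠ y' := fun h => hxy (π.injective h)
    set π₂ := swap y y' * (swap x x' * π) with hπ₂
    have hπ₂' : π = swap x x' * (swap y y' * π₂) := by
      rw [hπ₂, ← mul_assoc (swap y y'), swap_mul_self, one_mul, ← mul_assoc, swap_mul_self, one_mul]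
    have hπx : π₂ x = x := by
      simp only [hπ₂, Perm.mul_apply, ← hx'def, swap_apply_right]
      exact swap_apply_of_ne_of_ne hxy (Ne.symm hyx')
    have hπy : π₂ y = y := by
      simp only [hπ₂, Perm.mul_apply, ← hy'def]
      rw [swap_apply_of_ne_of_ne hyx' (Ne.symm hx'y'), swap_apply_right]
    have hπx' : π₂ x' = x' := by
      simp only [hπ₂, Perm.mul_apply, hix, swap_apply_left]
      exact swap_apply_of_ne_of_ne hxy' hx'y'
    have hπy' : π₂ y' = y' := by
      simp only [hπ₂, Perm.mul_apply, hiy]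
      rw [swap_apply_of_ne_of_ne (Ne.symm hxy) (Ne.symm hxy'), swap_apply_left]
    have hne : ∀ {z}, z ≠ x → z ≠ y → z ≠ x' → z ≠ y' →
        π z ≠ x ∧ π z ≠ y ∧ π z ≠ x' ∧ π z ≠ y' := fun {z} h₁ h₂ h₃ h₄ =>
      ⟨fun h => h₃ (π.injective (h.trans hix.symm)), fun h => h₄ (π.injective (h.trans hiy.symm)),
        fun h => h₁ (π.injective h), fun h => h₂ (π.injective h)⟩
    have hπ : ∀ {z}, z ≠ x → z ≠ y → z ≠ x' → z ≠ y' → (swap x' y' * π₂) z = π z := by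
      intro z h₁ h₂ h₃ h₄
      obtain ⟨g₁, g₂, g₃, g₄⟩ := hne h₁ h₂ h₃ h₄
      simp only [hπ₂, Perm.mul_apply]
      rw [swap_apply_of_ne_of_ne g₁ g₃, swap_apply_of_ne_of_ne g₂ g₄, swap_apply_of_ne_of_ne g₃ g₄]
    have hx₁ : (swap x' y' * π₂) x = x := by
      rw [Perm.mul_apply, hπx, swap_apply_of_ne_of_ne (Ne.symm hx') (Ne.symm hyx')]
    have hy₁ : (swap x' y' * π₂) y = y := by
      rw [Perm.mul_apply, hπy, swap_apply_of_ne_of_ne (Ne.symm hxy') (Ne.symm hy')]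
    have hx₂ : (swap x' y' * π₂) x' = y' := by rw [Perm.mul_apply, hπx', swap_apply_left]
    have hy₂ : (swap x' y' * π₂) y' = x' := by rw [Perm.mul_apply, hπy', swap_apply_right]
    -- `π₂` is `π` without the pairs of `x` and `y`; the new pairing adds the pair of `x'` and `y'`
    -- to it.
    rw [hπ₂'] at hs
    obtain ⟨i, hij, hs'⟩ := hs.of_cancel hσx hσy hπx hπy hxy (Ne.symm hxq) (Ne.symm hyq) hx' hxy' hyx'
      hy' hx'y'
    refine key hx₁ hy₁ (fun z => ?_) (fun z h₁ h₂ hz => ?_) (fun z h₁ h₂ hz => ?_) hij hs'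
    · by_cases h₁ : z = x
      · rw [h₁, hx₁, hx₁]
      by_cases h₂ : z = y
      · rw [h₂, hy₁, hy₁]
      by_cases h₃ : z = x'
      · rw [h₃, hx₂, hy₂]
      by_cases h₄ : z = y'
      · rw [h₄, hy₂, hx₂]
      obtain ⟨g₁, g₂, g₃, g₄⟩ := hne h₁ h₂ h₃ h₄
      rw [hπ h₁ h₂ h₃ h₄, hπ g₁ g₂ g₃ g₄, hp.invol]
    · have h₃ : z ≠ x' := fun h => hx' (by rw [← h, ← hz, h, hix] )
      have h₄ : z ≠ y' := fun h => hy' (by rw [← h, ← hz, h, hiy])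
      rw [hπ h₁ h₂ h₃ h₄, hz]
    · by_cases h₃ : z = x'
      · rw [h₃, hx₂, hly', hlx', hlx, hly]
      by_cases h₄ : z = y'
      · rw [h₄, hy₂, hlx', hly', hly, letterInv_letterInv, hlx]
      rw [hπ h₁ h₂ h₃ h₄]
      exact hp.label z (by simp at hz ⊢; tauto)

end Pairings

/-! ### Conjugation, removal of points from cycles, a standard involution -/

section SwapProducts

variable {α : Type*} [DecidableEq α]

theorem IsSwapProd.conj : ∀ {j : ℕ} {f : Perm α}, IsSwapProd j f → ∀ g : Perm α,
    IsSwapProd j (g * f * g⁻¹)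
  | 0, f, h, g => by rw [show f = 1 from h, mul_one, mul_inv_cancel]; exact isSwapProd_one 0
  | _ + 1, _, .inl h, g => (h.conj g).succ
  | _ + 1, _, .inr ⟨a, b, f, h, rfl⟩, g => by
    refine .inr ⟨g a, g b, _, h.conj g, ?_⟩
    rw [← mul_assoc, mul_swap_eq_swap_mul]
    simp only [mul_assoc]

theorem formPerm_map_perm (f : Perm α) : ∀ l : List α,
    (l.map f).formPerm = f * l.formPerm * f⁻¹
  | [] => by simp
  | [x] => by simp
  | x :: y :: l => by
    have := formPerm_map_perm f (y :: l)
    simp only [List.map_cons, List.formPerm_cons_cons] at this ⊢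
    rw [this, ← mul_assoc f (swap x y), mul_swap_eq_swap_mul]
    simp only [mul_assoc]

/-- Removing from the cycles of `φ` the points of a list, no point of which is mapped into the
list. -/
theorem IsSwapProd.exists_cut {φ : Perm α} {i : ℕ} {p : α → Prop} (hp : ∀ b, p b → ¬ p (φ b)) :
    ∀ {S : List α}, S.Nodup → (∀ b ∈ S, p b) → IsSwapProd (i + S.length) φ →
      ∃ g : Perm α, IsSwapProd i g ∧
        ∀ z, g z = if z ∈ S then z else if φ z ∈ S then φ (φ z) else φ z := by
  intro S
  induction S generalizing i with
  | nil => exact fun _ _ h => ⟨φ, h, by simp⟩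
  | cons b S ih =>
    intro hS hSp h
    rw [List.nodup_cons] at hS
    have hb := hSp b (by simp)
    obtain ⟨g, hg, hgz⟩ := ih (i := i + 1) hS.2 (fun c hc => hSp c (by simp [hc]))
      (h.mono (by simp; omega))
    have hφS : φ b ∉ S := fun h => hp b hb (hSp _ (by simp [h]))
    have hφb : φ b ≠ b := fun h => hp b hb (h.symm ▸ hb)
    have hgb : g b = φ b := by rw [hgz, if_neg hS.1, if_neg hφS]
    refine ⟨swap b (φ b) * g, ?_, fun z => ?_⟩
    · rw [← hgb]
      exact hg.swap_apply_mul (by rwa [hgb])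
    · rw [Perm.mul_apply]
      by_cases h₁ : z = b
      · rw [h₁, hgb, swap_apply_right, if_pos List.mem_cons_self]
      by_cases h₂ : z ∈ S
      · rw [hgz, if_pos h₂, if_pos (List.mem_cons_of_mem _ h₂)]
        exact swap_apply_of_ne_of_ne h₁ (fun h => hφS (h ▸ h₂))
      rw [hgz, if_neg h₂, if_neg (c := z ∈ b :: S) (by simp [h₁, h₂])]
      by_cases h₃ : φ z = b
      · rw [h₃, if_neg hS.1, swap_apply_left, if_pos List.mem_cons_self]
      by_cases h₄ : φ z ∈ S
      · rw [if_pos h₄, if_pos (List.mem_cons_of_mem _ h₄)]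
        refine swap_apply_of_ne_of_ne (fun h => ?_) (fun h => h₃ (φ.injective h))
        exact hp _ (hSp (φ z) (by simp [h₄])) (h.symm ▸ hb)
      · rw [if_neg h₄, if_neg (c := φ z ∈ b :: S) (by simp [h₃, h₄])]
        exact swap_apply_of_ne_of_ne h₃ fun h => h₁ (φ.injective h)

/-- The involution of `ℕ` that exchanges `2 i` and `2 i + 1` for `i < n`. -/
def neighbourSwap : ℕ → Perm ℕ
  | 0 => 1
  | n + 1 => swap (2 * n) (2 * n + 1) * neighbourSwap n

theorem isSwapProd_neighbourSwap : ∀ n, IsSwapProd n (neighbourSwap n)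
  | 0 => rfl
  | n + 1 => (isSwapProd_neighbourSwap n).swap_mul _ _

theorem neighbourSwap_of_le {n z : ℕ} (h : 2 * n ≤ z) : neighbourSwap n z = z := by
  induction n with
  | zero => rfl
  | succ n ih =>
    rw [neighbourSwap, Perm.mul_apply, ih (by omega), swap_apply_of_ne_of_ne] <;> omega

theorem neighbourSwap_of_lt {n i : ℕ} (h : i < n) :
    neighbourSwap n (2 * i) = 2 * i + 1 ∧ neighbourSwap n (2 * i + 1) = 2 * i := by
  induction n with
  | zero => omega
  | succ n ih =>
    simp only [neighbourSwap, Perm.mul_apply]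
    rcases Nat.lt_succ_iff_lt_or_eq.1 h with h | rfl
    · rw [(ih h).1, (ih h).2, swap_apply_of_ne_of_ne, swap_apply_of_ne_of_ne] <;> omega
    · rw [neighbourSwap_of_le (by omega), neighbourSwap_of_le (by omega)]
      simp

end SwapProducts

/-! ### From products of commutators to short sequences of interchanges -/

section Pairings

variable {A : Type*} {X Y : List (A × Bool)} {m : ℕ}

/-- Even positions carry X and odd ones the inverse letters, in reverse order. The second cycle is
then the π-conjugate of the inverse of the first, so the product collapses to a conjugate of π: one
transposition per letter of X. -/
theorem hasPairing_invRev {X : List (A × Bool)} (hX : X ≠ []) :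
    HasPairing (FreeGroup.invRev X) 0 X := by
  let x₀ := X.head hX
  set n := X.length with hn
  set π := neighbourSwap n with hπ
  set L := (List.range n).map (2 * ·) with hL
  have hLπ : L.map π = (List.range n).map (2 * · + 1) := by
    rw [hL, List.map_map]
    exact List.map_congr_left fun i hi => (neighbourSwap_of_lt (List.mem_range.1 hi)).1
  have hmL : ∀ z, z ∈ L ↔ ∃ i < n, 2 * i = z := by simp [hL]
  have hmM : ∀ z, z ∈ (L.map π).reverse ↔ ∃ i < n, 2 * i + 1 = z := by simp [hLπ]
  have hinv : ∀ z, π (π z) = z := fun z => by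
    by_cases hz : 2 * n ≤ z
    · rw [hπ, neighbourSwap_of_le hz, neighbourSwap_of_le hz]
    · obtain ⟨i, rfl | rfl⟩ := Nat.even_or_odd' z
      · have := neighbourSwap_of_lt (n := n) (i := i) (by omega)
        rw [hπ, this.1, this.2]
      · have := neighbourSwap_of_lt (n := n) (i := i) (by omega)
        rw [hπ, this.2, this.1]
  let l : ℕ → A × Bool := fun z =>
    if z % 2 = 0 then X.getD (z / 2) x₀ else letterInv (X.getD (z / 2) x₀)
  have hl₀ : ∀ i, l (2 * i) = X.getD i x₀ := fun i => by simp [l]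
  have hl₁ : ∀ i, l (2 * i + 1) = letterInv (X.getD i x₀) := fun i => by
    simp [l, Nat.add_mod, show (2 * i + 1) / 2 = i by omega]
  have hLX : L.map l = X := by
    apply List.ext_getElem
    · simp [hL, hn]
    · intro i h₁ h₂
      simp [hL, hl₀, h₂]
  refine ⟨L, (L.map π).reverse, l, π, n, ⟨?_, hinv, fun z hz hz' => ?_, fun z hz => ?_, hLX, ?_⟩,
    ?_, by simp [← hn]; omega⟩
  · have hLn : L.Nodup := (List.nodup_range).map fun a b h => by simpa using h
    refine List.Nodup.append hLn (List.nodup_reverse.2 (hLn.map π.injective)) fun z hz hz' => ?_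
    obtain ⟨i, -, rfl⟩ := (hmL z).1 hz
    obtain ⟨j, -, hj⟩ := (hmM _).1 hz'
    omega
  · refine neighbourSwap_of_le ?_
    by_contra! h
    obtain ⟨i, rfl | rfl⟩ := Nat.even_or_odd' z
    · exact hz ((hmL _).2 ⟨i, by omega, rfl⟩)
    · exact hz' ((hmM _).2 ⟨i, by omega, rfl⟩)
  · rcases hz with hz | hz
    · obtain ⟨i, hi, rfl⟩ := (hmL z).1 hz
      rw [hπ, (neighbourSwap_of_lt hi).1, hl₀, hl₁]
    · obtain ⟨i, hi, rfl⟩ := (hmM z).1 hz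
      rw [hπ, (neighbourSwap_of_lt hi).2, hl₀, hl₁, letterInv_letterInv]
  · rw [FreeGroup.invRev, ← hLX, List.map_reverse, hLπ, hL]
    simp only [List.map_map]
    congr 1
    refine List.map_congr_left fun i _ => ?_
    simp [hl₀, hl₁, letterInv]
  · rw [List.formPerm_reverse, formPerm_map_perm]
    convert (isSwapProd_neighbourSwap n).conj L.formPerm using 1
    have : π * π = 1 := Perm.ext hinv
    rw [← hπ, inv_eq_of_mul_eq_one_right this]
    simp only [mul_inv_rev, mul_assoc, inv_eq_of_mul_eq_one_right this, this, mul_one]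

theorem HasPairing.insert_middle {P Q : List (A × Bool)} (h : HasPairing Y m (P ++ Q))
    (hPQ : P ++ Q ≠ []) (a : A × Bool) : HasPairing Y m (P ++ a :: letterInv a :: Q) :=
  (h.append_comm.insert (by simpa [and_comm] using hPQ) a).append_comm (P := a :: letterInv a :: Q)

theorem HasPairing.insert_word {P Q : List (A × Bool)} (h : HasPairing Y m (P ++ Q))
    (hPQ : P ++ Q ≠ []) (u : List (A × Bool)) :
    HasPairing Y m (P ++ u ++ FreeGroup.invRev u ++ Q) := by
  induction u generalizing P Q with
  | nil => simpa using h
  | cons a u ih =>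
    have := ih (P := P ++ [a]) (Q := letterInv a :: Q) (by simpa using h.insert_middle hPQ a)
      (by simp)
    simpa [FreeGroup.invRev, letterInv] using this

theorem HasPairing.conj {X : List (A × Bool)} (h : HasPairing Y m X) (hX : X ≠ [])
    (t : List (A × Bool)) : HasPairing Y m (t ++ X ++ FreeGroup.invRev t) := by
  have := HasPairing.insert_word (P := X) (Q := []) (by simpa using h) (by simpa using hX)
    (FreeGroup.invRev t)
  rw [FreeGroup.invRev_invRev, List.append_nil] at this
  simpa using this.append_comm

/-- Insert `u u⁻¹ v v⁻¹` in front at no cost, then exchange the adjacent blocks `u⁻¹` and `v`; this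
exchange is the whole cost. -/
theorem HasPairing.commutator {X : List (A × Bool)} (h : HasPairing Y m X) (hX : X ≠ [])
    (u v : List (A × Bool)) :
    HasPairing Y (m + 2) (u ++ v ++ FreeGroup.invRev u ++ FreeGroup.invRev v ++ X) := by
  have h₁ := HasPairing.insert_word (P := []) (Q := X) h hX v
  have h₂ := HasPairing.insert_word (P := []) (by simpa using h₁) (by simp [hX]) u
  have h₃ : HasPairing Y m (u ++ (FreeGroup.invRev u ++ v ++ FreeGroup.invRev v ++ X)) := by
    simpa using h₂
  have h₄ : HasPairing Y m (FreeGroup.invRev v ++ X ++ (u ++ FreeGroup.invRev u ++ v)) :=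
    HasPairing.append_comm (by simpa using h₃)
  have h₅ := HasPairing.swap_blocks (P := FreeGroup.invRev v ++ X ++ u) (B := FreeGroup.invRev u)
    (C := v) (by simpa using h₄)
  simpa using HasPairing.append_comm (P := FreeGroup.invRev v ++ X)
    (Q := u ++ v ++ FreeGroup.invRev u) (by simpa using h₅)

theorem HasPairing.delete_middle {P Q : List (A × Bool)} {a : A × Bool}
    (h : HasPairing Y m (P ++ a :: letterInv a :: Q)) (hPQ : P ++ Q ≠ []) :
    HasPairing Y m (P ++ Q) :=
  (HasPairing.delete (by simpa [and_comm] using hPQ)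
    (h.append_comm (Q := a :: letterInv a :: Q))).append_comm

/-- Free reduction is a sequence of deletions. No intermediate word is empty, since the empty word
reduces only to itself. -/
theorem HasPairing.of_red {X Z : List (A × Bool)} (h : HasPairing Y m X) (hr : FreeGroup.Red X Z)
    (hZ : Z ≠ []) : HasPairing Y m Z := by
  induction hr using Relation.ReflTransGen.head_induction_on with
  | refl => exact h
  | head hs hr ih =>
    apply ih
    cases hs with
    | @not L₁ L₂ x b =>
      refine HasPairing.delete_middle (a := (x, b)) h fun h₀ => hZ ?_
      rw [h₀] at hr
      exact FreeGroup.Red.nil_iff.1 hr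

/-- A pairing of small genus between two positive words is a short sequence of block
interchanges. -/
theorem HasPairing.cbiReach {v w : List A} {k : ℕ} (hvw : v.length = w.length)
    (h : HasPairing (FreeGroup.invRev (w.map (·, true))) (2 * k) (v.map (·, true))) :
    CbiReach k v w := by
  obtain ⟨L, M, l, π, j, hp, hs, hj⟩ := h
  have hL : ∀ z ∈ L, (l z).2 = true := fun z hz => by
    have : l z ∈ v.map (·, true) := hp.map_left ▸ List.mem_map_of_mem hz
    obtain ⟨a, -, ha⟩ := List.mem_map.1 this
    rw [← ha]
  have hM : ∀ z ∈ M, (l z).2 = false := fun z hz => by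
    have : l z ∈ FreeGroup.invRev (w.map (·, true)) := hp.map_right ▸ List.mem_map_of_mem hz
    simp only [FreeGroup.invRev, List.map_map, List.mem_reverse, List.mem_map] at this
    obtain ⟨a, -, ha⟩ := this
    rw [← ha]; rfl
  -- L carries only positive letters and M only inverse ones, so π is a bijection between them.
  have hLM : ∀ z ∈ L, π z ∈ M := fun z hz => (hp.mem (.inl hz)).resolve_left fun h => by
    have := hL _ h
    rw [hp.label z (.inl hz)] at this
    simp [letterInv, hL z hz] at this
  have hML : ∀ z ∈ M, π z ∈ L := fun z hz => (hp.mem (.inr hz)).resolve_right fun h => by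
    have := hM _ h
    rw [hp.label z (.inr hz)] at this
    simp [letterInv, hM z hz] at this
  have hnL : L.Nodup := (List.nodup_append.1 hp.nodup).1
  have hnM : M.Nodup := (List.nodup_append.1 hp.nodup).2.1
  have hdisj : ∀ {z}, z ∈ L → z ∈ M → False := fun h h' =>
    List.disjoint_of_nodup_append hp.nodup h h'
  set φ := L.formPerm * M.formPerm * π with hφ
  have hφM : ∀ z ∈ M, φ z ∈ L := fun z hz => by
    rw [hφ, Perm.mul_apply, Perm.mul_apply,
      List.formPerm_apply_of_notMem fun h => hdisj (hML z hz) h]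
    exact List.formPerm_apply_mem_of_mem (hML z hz)
  have hφL : ∀ z ∈ L, φ z = M.formPerm (π z) := fun z hz => by
    rw [hφ, Perm.mul_apply, Perm.mul_apply, List.formPerm_apply_of_notMem fun h => hdisj h
      (List.formPerm_apply_mem_of_mem (hLM z hz))]
  have hMl : M.length = w.length := by
    have := congrArg List.length hp.map_right
    simpa using this
  -- Of the at most `|w| + 2 k` transpositions, `|w|` are spent on removing the points of M, no two
  -- of which are consecutive in a cycle of `φ`.
  obtain ⟨g, hg, hgz⟩ := IsSwapProd.exists_cut (i := 2 * k) (φ := φ) (p := (· ∈ M))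
    (fun b hb h => hdisj (hφM b hb) h) hnM (fun _ h => h)
    (hs.mono (by simp [hvw] at hj; omega))
  have hπ : π⁻¹ = π := inv_eq_of_mul_eq_one_right (Perm.ext hp.invol)
  -- The word `w` spelled on the positions of `v`; M lists `w⁻¹`, hence the reversal.
  set W := (M.map π).reverse with hW
  have hWL : L.Perm W := by
    rw [List.perm_ext_iff_of_nodup hnL (List.nodup_reverse.2 (hnM.map π.injective))]
    intro z
    simp only [List.mem_reverse, List.mem_map]
    exact ⟨fun hz => ⟨π z, hLM z hz, hp.invol z⟩, fun ⟨y, hy, e⟩ => e ▸ hML y hy⟩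
  have hgρ : g = L.formPerm * W.formPerm⁻¹ := by
    ext z
    rw [hgz, hW, List.formPerm_reverse, formPerm_map_perm, hπ, inv_inv]
    simp only [Perm.mul_apply]
    by_cases hzM : z ∈ M
    · rw [if_pos hzM, List.formPerm_apply_of_notMem (l := M) fun h => hdisj (hML z hzM) h, hp.invol,
        List.formPerm_apply_of_notMem fun h => hdisj h hzM]
    rw [if_neg hzM]
    by_cases hzL : z ∈ L
    · have : M.formPerm (π z) ∈ M := List.formPerm_apply_mem_of_mem (hLM z hzL)
      rw [hφL z hzL, if_pos this, hφ, Perm.mul_apply, Perm.mul_apply,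
        List.formPerm_apply_of_notMem (l := M) fun h => hdisj (hML _ this) h]
    · have hz := hp.fix z hzL hzM
      have hφz : φ z = z := by
        rw [hφ, Perm.mul_apply, Perm.mul_apply, hz, List.formPerm_apply_of_notMem hzM,
          List.formPerm_apply_of_notMem hzL]
      rw [hφz, if_neg hzM, hz, List.formPerm_apply_of_notMem hzM, hz,
          List.formPerm_apply_of_notMem hzL]
  have hmapL : L.map (fun z => (l z).1) = v := by
    have := congrArg (List.map Prod.fst) hp.map_left
    simpa [Function.comp_def] using this
  have hmapW : W.map (fun z => (l z).1) = w := by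
    have := congrArg (fun l => (List.map Prod.fst l).reverse) hp.map_right
    simp only [FreeGroup.invRev, List.map_map, List.map_reverse, List.reverse_reverse] at this
    simp only [Function.comp_def, List.map_id'] at this
    rw [hW, ← List.map_reverse, List.map_map, ← this, ← List.map_reverse]
    refine List.map_congr_left fun z hz => ?_
    simp [hp.label z (.inr (by simpa using hz)), letterInv]
  have := (cbiReach_of_isSwapProd hnL hWL (hgρ ▸ hg)).map fun z => (l z).1
  rwa [hmapL, hmapW] at this

end Pairings

/-! ### Products of commutators -/

section CommutatorProducts

variable {G : Type*} [Group G]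

/-- `g` is a product of `k` commutators. -/
def IsCommutatorProd : ℕ → G → Prop
  | 0, g => g = 1
  | k + 1, g => ∃ x y h, IsCommutatorProd k h ∧ g = x * y * x⁻¹ * y⁻¹ * h

theorem isCommutatorProd_iff : ∀ {k : ℕ} {g : G}, IsCommutatorProd k g ↔
    ∃ x y : Fin k → G, g = (List.ofFn fun i => x i * y i * (x i)⁻¹ * (y i)⁻¹).prod
  | 0, g => by simp [IsCommutatorProd]
  | k + 1, g => by
    simp only [IsCommutatorProd, isCommutatorProd_iff, List.ofFn_succ, List.prod_cons]
    constructor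
    · rintro ⟨x, y, h, ⟨x', y', rfl⟩, rfl⟩
      exact ⟨Fin.cons x x', Fin.cons y y', by simp⟩
    · rintro ⟨x, y, rfl⟩
      exact ⟨x 0, y 0, _, ⟨fun i => x i.succ, fun i => y i.succ, rfl⟩, rfl⟩

theorem IsCommutatorProd.succ : ∀ {k : ℕ} {g : G}, IsCommutatorProd k g →
    IsCommutatorProd (k + 1) g
  | 0, g, h => ⟨1, 1, g, h, by simp⟩
  | _ + 1, _, ⟨x, y, h, hh, e⟩ => ⟨x, y, h, hh.succ, e⟩

theorem IsCommutatorProd.mono {j k : ℕ} {g : G} (h : IsCommutatorProd j g) (hjk : j ≤ k) :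
    IsCommutatorProd k g := by
  induction hjk with
  | refl => exact h
  | step _ ih => exact ih.succ

theorem IsCommutatorProd.conj : ∀ {k : ℕ} {g : G}, IsCommutatorProd k g → ∀ t : G,
    IsCommutatorProd k (t * g * t⁻¹)
  | 0, g, h, t => by rw [show g = 1 from h]; simp [IsCommutatorProd]
  | _ + 1, _, ⟨x, y, h, hh, e⟩, t =>
    ⟨t * x * t⁻¹, t * y * t⁻¹, t * h * t⁻¹, hh.conj t, by rw [e]; group⟩

theorem commutatorLength_le_iff {k : ℕ} {g : G} :
    commutatorLength g ≤ k ↔ IsCommutatorProd k g := by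
  unfold commutatorLength
  constructor
  · intro h
    have h := lt_of_le_of_lt h (show (k : ℕ∞) < ((k + 1 : ℕ) : ℕ∞) by
      exact_mod_cast Nat.lt_succ_self k)
    simp only [iInf_lt_iff] at h
    obtain ⟨j, hj, hjk⟩ := h
    exact (isCommutatorProd_iff.2 hj).mono
      (Nat.lt_succ_iff.1 (by exact_mod_cast hjk))
  · exact fun h => iInf₂_le k (isCommutatorProd_iff.1 h)

/-- Commutator products are closed under conjugation, so the first conjugator may be taken to be
trivial. -/
theorem chainCommutatorLength_pair_le_iff {k : ℕ} {g h : G} :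
    chainCommutatorLength [g, h] ≤ k ↔ ∃ t, IsCommutatorProd k (g * (t * h * t⁻¹)) := by
  unfold chainCommutatorLength
  constructor
  · intro hk
    have hk := lt_of_le_of_lt hk (show (k : ℕ∞) < ((k + 1 : ℕ) : ℕ∞) by
      exact_mod_cast Nat.lt_succ_self k)
    rw [iInf_lt_iff] at hk
    obtain ⟨t, ht⟩ := hk
    have ht := commutatorLength_le_iff.1 (Order.le_of_lt_add_one (by exact_mod_cast ht))
    change IsCommutatorProd k (List.ofFn fun i : Fin 2 => t i * [g, h].get i * (t i)⁻¹).prod at ht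
    have := ht.conj (t 0)⁻¹
    refine ⟨(t 0)⁻¹ * t 1, ?_⟩
    convert this using 1
    simp [List.ofFn_succ, mul_assoc]
  · rintro ⟨t, ht⟩
    refine iInf_le_of_le (Fin.cons 1 (fun _ => t) : Fin 2 → G) (commutatorLength_le_iff.2 ?_)
    change IsCommutatorProd k (List.ofFn fun i : Fin 2 => (Fin.cons 1 (fun _ => t) : Fin 2 → G) i *
      [g, h].get i * ((Fin.cons 1 (fun _ => t) : Fin 2 → G) i)⁻¹).prod
    simpa [List.ofFn_succ] using ht

end CommutatorProducts

/-! ### Equality of distance and commutator length -/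

section Distance

variable {A : Type*}

theorem posWord_append (v w : List A) : posWord (v ++ w) = posWord v * posWord w := by
  simp [posWord]

theorem posWord_eq_mk : ∀ v : List A, posWord v = FreeGroup.mk (v.map (·, true))
  | [] => rfl
  | a :: v => by
    have := posWord_eq_mk v
    simp only [posWord, List.map_cons, List.prod_cons] at this ⊢
    rw [this, FreeGroup.of, FreeGroup.mul_mk]
    rfl

theorem exists_posWord_eq_conj {v w : List A} (h : v.IsRotated w) :
    ∃ s, posWord w = s * posWord v * s⁻¹ := by
  obtain ⟨n, hn, rfl⟩ := List.isRotated_iff_mod.1 h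
  refine ⟨(posWord (v.take n))⁻¹, ?_⟩
  rw [List.rotate_eq_drop_append_take hn, posWord_append]
  have : posWord v = posWord (v.take n) * posWord (v.drop n) := by
    rw [← posWord_append, List.take_append_drop]
  rw [this]
  group

/-- Up to rotation an interchange reverses the cyclic order of the four blocks, so all blocks play
the same role. Whichever block contains the start of `v` is cut into `p` and `s`, and the other
three are reversed. -/
theorem IsCyclicBlockInterchange.exists_append {v z : List A} (h : IsCyclicBlockInterchange v z) :
    ∃ s x y t p, v = s ++ x ++ y ++ t ++ p ∧ z.IsRotated (s ++ t ++ y ++ x ++ p) := by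
  obtain ⟨v', z', hr, hz, a, b, c, d, rfl, rfl⟩ := h
  obtain ⟨n, hn, hv⟩ := List.isRotated_iff_mod.1 hr
  clear hr
  rw [List.rotate_eq_drop_append_take hn] at hv
  have hv' := (List.take_append_drop n v).symm
  generalize v.take n = q at *
  generalize v.drop n = p at *
  subst hv'
  simp only [List.append_assoc] at hv
  rcases List.append_eq_append_iff.1 hv with ⟨s, rfl, rfl⟩ | ⟨p, rfl, hv₁⟩
  · exact ⟨s, b, c, d, p, by simp, hz.trans (by
      simpa using List.isRotated_append (l := p) (l' := s ++ d ++ c ++ b))⟩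
  rcases List.append_eq_append_iff.1 hv₁.symm with ⟨s, rfl, rfl⟩ | ⟨p, rfl, hv₂⟩
  · exact ⟨s, c, d, a, p, by simp, hz.trans (by
      simpa using List.isRotated_append (l := a ++ d ++ c ++ p) (l' := s))⟩
  rcases List.append_eq_append_iff.1 hv₂.symm with ⟨s, rfl, rfl⟩ | ⟨p, rfl, hv₃⟩
  · exact ⟨s, d, a, b, p, by simp, hz.trans (by
      simpa using List.isRotated_append (l := a ++ d ++ p) (l' := s ++ b))⟩
  · subst hv₃
    exact ⟨q, a, b, c, p, by simp, hz.trans (by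
      simpa using List.isRotated_append (l := a ++ p) (l' := q ++ c ++ b))⟩

theorem CbiReach.exists_isCommutatorProd : ∀ {k : ℕ} {v w : List A}, CbiReach k v w →
    ∃ w', w.IsRotated w' ∧ IsCommutatorProd k (posWord v * (posWord w')⁻¹)
  | 0, v, _, h => ⟨v, List.IsRotated.symm h, by simp [IsCommutatorProd]⟩
  | k + 1, v, w, ⟨z, h, h'⟩ => by
    obtain ⟨s, x, y, t, p, rfl, hz⟩ := h.exists_append
    obtain ⟨w', hw, hk⟩ := (h'.of_isRotated_left hz.symm).exists_isCommutatorProd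
    refine ⟨w', hw, ?_⟩
    -- These are `x y` and `t x⁻¹` conjugated by `s`; their commutator is the quotient of the words
    -- before and after the interchange.
    refine ⟨posWord s * (posWord x * posWord y) * (posWord s)⁻¹,
      posWord s * (posWord t * (posWord x)⁻¹) * (posWord s)⁻¹, _, hk, ?_⟩
    simp only [posWord_append]
    group

theorem HasPairing.exists_of_isCommutatorProd : ∀ {k : ℕ} {g : FreeGroup A},
    IsCommutatorProd k g → ∀ {Y X : List (A × Bool)} {m : ℕ}, X ≠ [] → HasPairing Y m X →
      ∃ P, FreeGroup.mk P = g ∧ HasPairing Y (m + 2 * k) (P ++ X)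
  | 0, g, hg, Y, X, m, _, h => ⟨[], by rw [show g = 1 from hg]; rfl, h⟩
  | k + 1, g, ⟨x, y, g', hg', e⟩, Y, X, m, hX, h => by
    classical
    obtain ⟨P, hP, h⟩ := HasPairing.exists_of_isCommutatorProd hg' hX h
    refine ⟨x.toWord ++ y.toWord ++ FreeGroup.invRev x.toWord ++ FreeGroup.invRev y.toWord ++ P,
      ?_, ?_⟩
    · rw [e, ← hP]
      simp only [← FreeGroup.mul_mk, ← FreeGroup.inv_mk, FreeGroup.mk_toWord]
    · have := h.commutator (by simp [hX]) x.toWord y.toWord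
      simpa [mul_add, add_assoc] using this

theorem isReduced_map_true (v : List A) : FreeGroup.IsReduced (v.map (·, true)) := by
  rw [FreeGroup.IsReduced, List.isChain_map]
  exact List.Pairwise.isChain (List.pairwise_of_forall fun _ _ _ => rfl)

/-- Multiplying the commutator product by `t w t⁻¹` gives `v`, which is reduced because it is
positive; thus the word reached by prepending the commutators reduces freely to `v` itself. -/
theorem cbiReach_of_isCommutatorProd {v w : List A} (hvw : Related v w) {k : ℕ} {t : FreeGroup A}
    (h : IsCommutatorProd k (posWord v * (t * (posWord w)⁻¹ * t⁻¹))) : CbiReach k v w := by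
  classical
  by_cases hv : v = []
  · subst hv
    rw [List.nil_perm.1 hvw]
    exact .refl _ k
  have hw : w ≠ [] := fun h => hv (by subst h; exact List.perm_nil.1 hvw)
  have h₀ := (hasPairing_invRev (X := w.map (·, true)) (by simpa using hw)).conj
    (by simpa using hw) t.toWord
  obtain ⟨P, hP, h₁⟩ := HasPairing.exists_of_isCommutatorProd h (by simp [hw]) h₀
  have e : FreeGroup.mk (P ++ (t.toWord ++ w.map (·, true) ++ FreeGroup.invRev t.toWord)) =
      FreeGroup.mk (v.map (·, true)) := by
    simp only [← FreeGroup.mul_mk, ← FreeGroup.inv_mk, FreeGroup.mk_toWord, hP, ← posWord_eq_mk]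
    group
  obtain ⟨Z, hZ₁, hZ₂⟩ := FreeGroup.Red.exact.1 e
  rw [(isReduced_map_true v).red_iff_eq] at hZ₂
  subst hZ₂
  have h₂ := h₁.of_red hZ₁ (by simpa using hv)
  rw [zero_add] at h₂
  exact h₂.cbiReach hvw.length_eq

theorem cbiReach_length_append {w : List A} : ∀ {v : List A}, v.Perm w → ∀ P,
    CbiReach w.length (P ++ v) (P ++ w) := by
  induction w with
  | nil => intro v h P; rw [List.perm_nil.1 h]; exact .refl _ _
  | cons b w ih =>
    intro v h P
    obtain ⟨Q, R, rfl⟩ := List.append_of_mem (h.mem_iff.2 (by simp : b ∈ b :: w))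
    -- Each interchange brings one letter of `w` to its place by exchanging it with the block `Q`
    -- before it; the block between them is empty.
    refine ⟨P ++ b :: (Q ++ R), ⟨R ++ P ++ Q ++ [] ++ [b], R ++ P ++ [b] ++ [] ++ Q, ?_, ?_,
      R ++ P, Q, [], [b], rfl, rfl⟩, ?_⟩
    · simpa using List.isRotated_append (l := P ++ Q ++ [b]) (l' := R)
    · simpa using List.isRotated_append (l := P ++ [b] ++ Q) (l' := R)
    · simpa using ih ((List.perm_cons b).1 (List.perm_middle.symm.trans h)) (P ++ [b])

theorem Related.cbiReach_length {v w : List A} (h : Related v w) : CbiReach v.length v w := by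
  have := cbiReach_length_append h []
  rwa [← h.length_eq] at this

theorem Related.cbiReach_iff {v w : List A} (h : Related v w) {k : ℕ} :
    CbiReach k v w ↔ ∃ w', w.IsRotated w' ∧ IsCommutatorProd k (posWord v * (posWord w')⁻¹) := by
  refine ⟨fun h => h.exists_isCommutatorProd, ?_⟩
  rintro ⟨w', hw, hk⟩
  obtain ⟨s, hs⟩ := exists_posWord_eq_conj hw
  refine cbiReach_of_isCommutatorProd h (t := s) ?_
  convert hk using 2
  rw [hs]
  group

theorem chainCommutatorLength_le_commutatorLength {v w w' : List A} (hw : w.IsRotated w') :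
    chainCommutatorLength [posWord v, (posWord w)⁻¹] ≤
      commutatorLength (posWord v * (posWord w')⁻¹) := by
  rcases h : commutatorLength (posWord v * (posWord w')⁻¹) with _ | k
  · exact le_top
  · obtain ⟨s, hs⟩ := exists_posWord_eq_conj hw
    refine chainCommutatorLength_pair_le_iff.2 ⟨s, ?_⟩
    convert commutatorLength_le_iff.1 h.le using 2
    rw [hs]
    group

theorem Related.cbiDist_eq {v w : List A} (h : Related v w) :
    cbiDist v w = chainCommutatorLength [posWord v, (posWord w)⁻¹] := by
  have key : ∀ k : ℕ, cbiDist v w ≤ k ↔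
      chainCommutatorLength [posWord v, (posWord w)⁻¹] ≤ k := fun k => by
    rw [cbiDist_le_iff]
    constructor
    · rw [h.cbiReach_iff]
      rintro ⟨w', hw, hk⟩
      exact (chainCommutatorLength_le_commutatorLength hw).trans (commutatorLength_le_iff.2 hk)
    · rw [chainCommutatorLength_pair_le_iff]
      rintro ⟨t, ht⟩
      exact cbiReach_of_isCommutatorProd h ht
  refine le_antisymm ?_ ?_
  · rcases hc : chainCommutatorLength [posWord v, (posWord w)⁻¹] with _ | k
    · exact le_top
    · exact (key k).2 hc.le
  · rcases hc : cbiDist v w with _ | k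
    · exact le_top
    · exact (key k).1 hc.le

theorem Related.cbiDist_le_length {v w : List A} (h : Related v w) :
    cbiDist v w ≤ v.length := cbiDist_le_iff.2 h.cbiReach_length

theorem Related.isLeast_chainCommutatorLength {v w : List A} (h : Related v w) :
    IsLeast {m : ℕ∞ | ∃ w' : List A, w.IsRotated w' ∧
      m = commutatorLength (posWord v * (posWord w')⁻¹)}
      (chainCommutatorLength [posWord v, (posWord w)⁻¹]) := by
  constructor
  · obtain ⟨k, hk⟩ := ENat.ne_top_iff_exists.1
      (ne_top_of_le_ne_top (ENat.natCast_ne_top _) h.cbiDist_le_length)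
    obtain ⟨w', hw, hw'⟩ := h.cbiReach_iff.1 (cbiDist_le_iff.1 hk.ge)
    refine ⟨w', hw, le_antisymm (chainCommutatorLength_le_commutatorLength hw) ?_⟩
    rw [← h.cbiDist_eq, ← hk]
    exact commutatorLength_le_iff.2 hw'
  · rintro m ⟨w', hw, rfl⟩
    exact chainCommutatorLength_le_commutatorLength hw

end Distance

/-! ### The Turing machine of the reduction -/

section Machine

/-- The stacks of the machine that reduces CBI to CL. -/
inductive ReductionStack
  | inp | out | fwd | bwd | cnt | rot
  deriving DecidableEq

instance : Fintype ReductionStack :=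
  ⟨{.inp, .out, .fwd, .bwd, .cnt, .rot}, by rintro (_ | _) <;> simp⟩

/-- The labels of the machine that reduces CBI to CL. -/
inductive ReductionLabel
  | readFirst | readSecond | move | count | start | emit | restore | next
  deriving DecidableEq

instance : Fintype ReductionLabel :=
  ⟨{.readFirst, .readSecond, .move, .count, .start, .emit, .restore, .next},
    by rintro (_ | _) <;> simp⟩

/-- The symbols in which inputs of CL are written. -/
abbrev CLSymbol (A : Type) := (A × Bool) ⊕ Unit

/-- The tape alphabets of the machine that reduces CBI to CL. -/
@[reducible] def reductionAlphabet (A : Type) : ReductionStack → Type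
  | .inp => A ⊕ Bool
  | .out => Option (CLSymbol A)
  | .fwd => CLSymbol A
  | .bwd => CLSymbol A
  | .cnt => CLSymbol A
  | .rot => CLSymbol A

/-- The internal states of the machine: a register for the symbol read last, and a letter
that is held back. -/
abbrev ReductionState (A : Type) := Option (CLSymbol A) × Option (CLSymbol A)

variable {A : Type}

/-- The letter of exponent `b` read from the input, if any. -/
def readLetter (b : Bool) (o : Option (A ⊕ Bool)) : Option (CLSymbol A) :=
  o.bind (Sum.elim (fun a => some (Sum.inl (a, b))) fun _ => none)

/-- The unary digit read from the input, if any. -/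
def readDigit (o : Option (A ⊕ Bool)) : Option (CLSymbol A) :=
  o.bind (Sum.elim (fun _ => none) fun _ => some (Sum.inr ()))

/-- Whether a symbol has to be held back (the first inverse letter), or makes the machine release
the letter that is held back (the first letter of exponent `1`). -/
def isTurning (h : Option (CLSymbol A)) : CLSymbol A → Bool
  | .inl (_, b) => b == h.isSome
  | .inr _ => false

/-- The content of the register, with a default value. -/
def ReductionState.symbol (s : ReductionState A) : CLSymbol A := s.1.getD (.inr ())

open Turing.TM2.Stmt in
/-- The program that writes down, for an input `(v, w, k)` of CBI, the inputs `(v w̃⁻¹, min k |v|)` of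
CL for all rotations `w̃` of `w`. -/
def reductionProgram :
    ReductionLabel → Turing.TM2.Stmt (reductionAlphabet A) ReductionLabel (ReductionState A)
  | .readFirst =>
    pop .inp (fun s o => (readLetter true o, s.2)) <|
    branch (fun s => s.1.isSome)
      (push .fwd ReductionState.symbol <| push .cnt (fun _ => .inr ()) <|
        push .rot (fun _ => .inr ()) <| goto fun _ => .readFirst)
      (goto fun _ => .readSecond)
  | .readSecond =>
    pop .inp (fun s o => (readLetter false o, s.2)) <|
    branch (fun s => s.1.isSome)
      (push .bwd ReductionState.symbol <| goto fun _ => .readSecond)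
      (goto fun _ => .move)
  | .move =>
    pop .bwd (fun s o => (o, s.2)) <|
    branch (fun s => s.1.isSome)
      (push .fwd ReductionState.symbol <| goto fun _ => .move)
      (goto fun _ => .count)
  | .count =>
    pop .cnt (fun s o => (o, s.2)) <|
    branch (fun s => s.1.isSome)
      (pop .inp (fun s o => (readDigit o, s.2)) <|
        branch (fun s => s.1.isSome)
          (push .fwd (fun _ => .inr ()) <| goto fun _ => .count)
          (goto fun _ => .start))
      (goto fun _ => .start)
  | .start =>
    push .out (fun _ => none) <| goto fun _ => .emit
  | .emit =>
    pop .fwd (fun s o => (o, s.2)) <|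
    branch (fun s => s.1.isSome)
      (push .out (fun s => some s.symbol) <|
        branch (fun s => isTurning s.2 s.symbol)
          (branch (fun s => s.2.isSome)
            (push .bwd (fun s => s.2.getD (.inr ())) <| push .bwd ReductionState.symbol <|
              load (fun s => (s.1, none)) <| goto fun _ => .emit)
            (load (fun s => (s.1, s.1)) <| goto fun _ => .emit))
          (push .bwd ReductionState.symbol <| goto fun _ => .emit))
      (goto fun _ => .restore)
  | .restore =>
    pop .bwd (fun s o => (o, s.2)) <|
    branch (fun s => s.1.isSome)
      (push .fwd ReductionState.symbol <| goto fun _ => .restore)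
      (goto fun _ => .next)
  | .next =>
    pop .rot (fun s o => (o, s.2)) <|
    branch (fun s => s.1.isSome) (goto fun _ => .start) halt

/-- The stacks with given contents. -/
def reductionStacks (i : List (A ⊕ Bool)) (o : List (Option (CLSymbol A)))
    (f b c r : List (CLSymbol A)) : ∀ k, List (reductionAlphabet A k)
  | .inp => i
  | .out => o
  | .fwd => f
  | .bwd => b
  | .cnt => c
  | .rot => r

section Update

variable (i i' : List (A ⊕ Bool)) (o o' : List (Option (CLSymbol A)))
    (f b c r x : List (CLSymbol A))

@[simp] theorem update_reductionStacks_inp :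
    Function.update (reductionStacks i o f b c r) .inp i' = reductionStacks i' o f b c r := by
  funext k; cases k <;> rfl

@[simp] theorem update_reductionStacks_out :
    Function.update (reductionStacks i o f b c r) .out o' = reductionStacks i o' f b c r := by
  funext k; cases k <;> rfl

@[simp] theorem update_reductionStacks_fwd :
    Function.update (reductionStacks i o f b c r) .fwd x = reductionStacks i o x b c r := by
  funext k; cases k <;> rfl

@[simp] theorem update_reductionStacks_bwd :
    Function.update (reductionStacks i o f b c r) .bwd x = reductionStacks i o f x c r := by
  funext k; cases k <;> rfl

@[simp] theorem update_reductionStacks_cnt :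
    Function.update (reductionStacks i o f b c r) .cnt x = reductionStacks i o f b x r := by
  funext k; cases k <;> rfl

@[simp] theorem update_reductionStacks_rot :
    Function.update (reductionStacks i o f b c r) .rot x = reductionStacks i o f b c x := by
  funext k; cases k <;> rfl

@[simp] theorem reductionStacks_inp : reductionStacks i o f b c r .inp = i := rfl
@[simp] theorem reductionStacks_out : reductionStacks i o f b c r .out = o := rfl
@[simp] theorem reductionStacks_fwd : reductionStacks i o f b c r .fwd = f := rfl
@[simp] theorem reductionStacks_bwd : reductionStacks i o f b c r .bwd = b := rfl
@[simp] theorem reductionStacks_cnt : reductionStacks i o f b c r .cnt = c := rfl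
@[simp] theorem reductionStacks_rot : reductionStacks i o f b c r .rot = r := rfl

end Update

/-- Configurations of the machine that reduces CBI to CL. -/
abbrev ReductionCfg (A : Type) :=
  Turing.TM2.Cfg (reductionAlphabet A) ReductionLabel (ReductionState A)

/-- The machine gets from `c` to `c'` in `n` steps. -/
inductive ReductionRun : ℕ → ReductionCfg A → ReductionCfg A → Prop
  | refl (c) : ReductionRun 0 c c
  | step {n c c' c''} : Turing.TM2.step reductionProgram c = some c' → ReductionRun n c' c'' →
      ReductionRun (n + 1) c c''

theorem ReductionRun.trans {m n : ℕ} {c c' c'' : ReductionCfg A} (h : ReductionRun m c c')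
    (h' : ReductionRun n c' c'') : ReductionRun (m + n) c c'' := by
  induction h with
  | refl => simpa using h'
  | @step m c₁ c₂ c₃ hs _ ih =>
    rw [show m + 1 + n = m + n + 1 by omega]
    exact .step hs (ih h')

theorem ReductionRun.iterate_eq {n : ℕ} {c c' : ReductionCfg A} (h : ReductionRun n c c') :
    (flip bind (Turing.TM2.step reductionProgram))^[n] (some c) = some c' := by
  induction h with
  | refl => rfl
  | step hs _ ih =>
    rw [Function.iterate_succ_apply, ← ih, ← hs]
    rfl

variable {i : List (A ⊕ Bool)} {o : List (Option (CLSymbol A))} {f b c r : List (CLSymbol A)}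
  {x h : Option (CLSymbol A)}

theorem replicate_append_cons {B : Type*} (n : ℕ) (a : B) (l : List B) :
    List.replicate n a ++ a :: l = a :: (List.replicate n a ++ l) := by
  rw [← List.cons_append, ← List.replicate_succ, List.replicate_succ', List.append_assoc,
    List.singleton_append]

theorem reductionRun_readFirst (v : List A) :
    ReductionRun (v.length + 1)
      ⟨some .readFirst, (x, h), reductionStacks (v.map .inl ++ .inr false :: i) o f b c r⟩
      ⟨some .readSecond, (none, h), reductionStacks i o (v.reverse.map (fun a => .inl (a, true)) ++ f) b
        (List.replicate v.length (.inr ()) ++ c) (List.replicate v.length (.inr ()) ++ r)⟩ := by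
  induction v generalizing x f c r with
  | nil => exact .step (by simp [reductionProgram, readLetter]) (.refl _)
  | cons a v ih =>
    refine .step (c' := ⟨some .readFirst, (some (.inl (a, true)), h),
      reductionStacks (v.map .inl ++ .inr false :: i) o (.inl (a, true) :: f) b (.inr () :: c)
        (.inr () :: r)⟩) (by simp [reductionProgram, readLetter, ReductionState.symbol]) ?_
    have := ih (x := some (.inl (a, true))) (f := .inl (a, true) :: f) (c := .inr () :: c)
      (r := .inr () :: r)
    simpa [replicate_append_cons, List.replicate_succ] using this

theorem reductionRun_readSecond (v : List A) :
    ReductionRun (v.length + 1)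
      ⟨some .readSecond, (x, h), reductionStacks (v.map .inl ++ .inr false :: i) o f b c r⟩
      ⟨some .move, (none, h), reductionStacks i o f
        (v.reverse.map (fun a => .inl (a, false)) ++ b) c r⟩ := by
  induction v generalizing x b with
  | nil => exact .step (by simp [reductionProgram, readLetter]) (.refl _)
  | cons a v ih =>
    refine .step (c' := ⟨some .readSecond, (some (.inl (a, false)), h),
      reductionStacks (v.map .inl ++ .inr false :: i) o f (.inl (a, false) :: b) c r⟩)
      (by simp [reductionProgram, readLetter, ReductionState.symbol]) ?_
    have := ih (x := some (.inl (a, false))) (b := .inl (a, false) :: b)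
    simpa using this

theorem reductionRun_move : ReductionRun (b.length + 1)
      ⟨some .move, (x, h), reductionStacks i o f b c r⟩
      ⟨some .count, (none, h), reductionStacks i o (b.reverse ++ f) [] c r⟩ := by
  induction b generalizing x f with
  | nil => exact .step (by simp [reductionProgram]) (.refl _)
  | cons a b ih =>
    refine .step (c' := ⟨some .move, (some a, h), reductionStacks i o (a :: f) b c r⟩)
      (by simp [reductionProgram, ReductionState.symbol]) ?_
    simpa using ih (x := some a) (f := a :: f)

theorem reductionRun_restore : ReductionRun (b.length + 1)
      ⟨some .restore, (x, h), reductionStacks i o f b c r⟩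
      ⟨some .next, (none, h), reductionStacks i o (b.reverse ++ f) [] c r⟩ := by
  induction b generalizing x f with
  | nil => exact .step (by simp [reductionProgram]) (.refl _)
  | cons a b ih =>
    refine .step (c' := ⟨some .restore, (some a, h), reductionStacks i o (a :: f) b c r⟩)
      (by simp [reductionProgram, ReductionState.symbol]) ?_
    simpa using ih (x := some a) (f := a :: f)

theorem reductionRun_count (n k : ℕ) : ∃ t ≤ n + 1, ∃ i' c', ReductionRun t
      ⟨some .count, (x, h), reductionStacks (List.replicate k (.inr true)) o f b
        (List.replicate n (.inr ())) r⟩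
      ⟨some .start, (none, h), reductionStacks i' o (List.replicate (min k n) (.inr ()) ++ f) b c' r⟩ := by
  induction n generalizing k x f with
  | zero =>
    exact ⟨1, by omega, List.replicate k (.inr true), [],
      .step (by simp [reductionProgram]) (.refl _)⟩
  | succ n ih =>
    cases k with
    | zero =>
      exact ⟨1, by omega, [], List.replicate n (.inr ()),
        .step (by simp [reductionProgram, readDigit, List.replicate_succ]) (.refl _)⟩
    | succ k =>
      obtain ⟨t, ht, i', c', hr⟩ := ih k (x := some (.inr ())) (f := .inr () :: f)
      refine ⟨t + 1, by omega, i', c', .step (c' := ⟨some .count, (some (.inr ()), h),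
        reductionStacks (List.replicate k (.inr true)) o (.inr () :: f) b
          (List.replicate n (.inr ())) r⟩)
        (by simp [reductionProgram, readDigit, List.replicate_succ]) ?_⟩
      simpa [Nat.succ_min_succ, List.replicate_succ, replicate_append_cons] using hr

theorem reductionRun_emit_append (l : List (CLSymbol A)) (hl : ∀ s ∈ l, isTurning h s = false) :
    ∃ y, ReductionRun l.length
      ⟨some .emit, (x, h), reductionStacks i o (l ++ f) b c r⟩
      ⟨some .emit, (y, h), reductionStacks i ((l.map some).reverse ++ o) f (l.reverse ++ b) c r⟩ := by
  induction l generalizing x o b with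
  | nil => exact ⟨x, .refl _⟩
  | cons a l ih =>
    obtain ⟨y, hy⟩ := ih (x := some a) (o := some a :: o) (b := a :: b)
      fun s hs => hl s (by simp [hs])
    refine ⟨y, .step (c' := ⟨some .emit, (some a, h), reductionStacks i (some a :: o) (l ++ f)
      (a :: b) c r⟩) ?_ ?_⟩
    · have := hl a (by simp)
      simp [reductionProgram, ReductionState.symbol, this]
    · simpa using hy

/-- The content of the stack from which an input of CL is copied to the output. -/
def emissionList (k : ℕ) (u v : List A) : List (CLSymbol A) :=
  List.replicate k (.inr ()) ++ (u.map (fun a => .inl (a, false)) ++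
    v.map (fun a => .inl (a, true)))

/-- While the list is copied to the output, the first inverse letter is kept back and put after the
other inverse letters in the second copy. That copy therefore holds the next rotation. -/
theorem reductionRun_emit {k : ℕ} {u v : List A} (huv : u.length = v.length) :
    ReductionRun ((emissionList k u v).length + 1)
      ⟨some .emit, (x, none), reductionStacks i o (emissionList k u v) b c r⟩
      ⟨some .restore, (none, none), reductionStacks i
        (((emissionList k u v).map some).reverse ++ o) []
        ((emissionList k (u.rotate 1) v).reverse ++ b) c r⟩ := by
  obtain ⟨y, hy⟩ := reductionRun_emit_append (h := none) (x := x) (i := i) (o := o) (b := b) (c := c)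
    (r := r) (f := u.map (fun a => .inl (a, false)) ++ v.map (fun a => .inl (a, true)))
    (List.replicate k (.inr ())) (by simp [isTurning])
  match u, v, huv with
  | [], [], _ =>
    have := hy.trans (.step (c' := ⟨some .restore, (none, none), reductionStacks i
      (((emissionList k ([] : List A) []).map some).reverse ++ o) []
        ((emissionList k ([] : List A) []).reverse ++ b) c r⟩) ?_ (.refl _))
    · simpa [emissionList] using this
    · simp [reductionProgram, emissionList]
  | a :: u, a' :: v, _ =>
    set o₁ := ((List.replicate k (Sum.inr ())).map some).reverse ++ o with ho₁
    set b₁ := (List.replicate k (Sum.inr ())).reverse ++ b with hb₁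
    obtain ⟨y', hy'⟩ := reductionRun_emit_append (h := some (.inl (a, false)))
      (x := some (.inl (a, false))) (i := i) (o := some (.inl (a, false)) :: o₁) (b := b₁) (c := c)
      (r := r) (f := (a' :: v).map (fun a => .inl (a, true)))
      (u.map (fun a => .inl (a, false))) (by simp [isTurning])
    set o₂ := ((u.map (fun a => Sum.inl (a, false))).map some).reverse ++
      some (.inl (a, false)) :: o₁ with ho₂
    set b₂ := (u.map (fun a => Sum.inl (a, false))).reverse ++ b₁ with hb₂
    obtain ⟨y'', hy''⟩ := reductionRun_emit_append (h := none)
      (x := some (.inl (a', true))) (i := i) (o := some (.inl (a', true)) :: o₂)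
      (b := .inl (a', true) :: .inl (a, false) :: b₂) (c := c)
      (r := r) (f := []) (v.map (fun a => .inl (a, true))) (by simp [isTurning])
    have s₁ : Turing.TM2.step reductionProgram ⟨some .emit, (y, none), reductionStacks i o₁
        ((a :: u).map (fun a => .inl (a, false)) ++ (a' :: v).map (fun a => .inl (a, true))) b₁ c r⟩ =
        some ⟨some .emit, (some (.inl (a, false)), some (.inl (a, false))), reductionStacks i
          (some (.inl (a, false)) :: o₁) (u.map (fun a => .inl (a, false)) ++
          (a' :: v).map (fun a => .inl (a, true))) b₁ c r⟩ := by
      simp [reductionProgram, ReductionState.symbol, isTurning]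
    have s₂ : Turing.TM2.step reductionProgram ⟨some .emit, (y', some (.inl (a, false))),
        reductionStacks i o₂ ((a' :: v).map (fun a => .inl (a, true))) b₂ c r⟩ =
        some ⟨some .emit, (some (.inl (a', true)), none), reductionStacks i
          (some (.inl (a', true)) :: o₂) (v.map (fun a => .inl (a, true)) ++ [])
          (.inl (a', true) :: .inl (a, false) :: b₂) c r⟩ := by
      simp [reductionProgram, ReductionState.symbol, isTurning]
    have s₃ : ∀ o b, Turing.TM2.step (reductionProgram (A := A)) ⟨some .emit, (y'', none),
        reductionStacks i o [] b c r⟩ =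
        some ⟨some .restore, (none, none), reductionStacks i o [] b c r⟩ := by
      simp [reductionProgram]
    have := hy.trans (.step s₁ (hy'.trans (.step s₂ (hy''.trans (.step (s₃ _ _) (.refl _))))))
    convert this using 1
    · simp [emissionList]; omega
    · rfl
    · simp [emissionList, ho₁, ho₂, hb₁, hb₂]

theorem reductionRun_round {k : ℕ} {u v : List A} (huv : u.length = v.length) :
    ReductionRun (2 * (emissionList k u v).length + 3)
      ⟨some .start, (x, none), reductionStacks i o (emissionList k u v) [] c r⟩
      ⟨some .next, (none, none), reductionStacks i
        (((emissionList k u v).map some).reverse ++ none :: o)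
        (emissionList k (u.rotate 1) v) [] c r⟩ := by
  have h₁ := reductionRun_emit (x := x) (i := i) (o := none :: o) (b := []) (c := c) (r := r)
    (k := k) huv
  have h₂ := reductionRun_restore (x := none) (h := none) (i := i)
    (o := ((emissionList k u v).map some).reverse ++ none :: o) (f := [])
    (b := (emissionList k (u.rotate 1) v).reverse) (c := c) (r := r)
  rw [List.append_nil] at h₁
  have := ReductionRun.step (c := ⟨some .start, (x, none), reductionStacks i o (emissionList k u v) [] c r⟩)
    (by simp [reductionProgram]) (h₁.trans h₂)
  convert this using 1
  · simp [emissionList]; omega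
  · simp

/-- The output of the machine, when `j` further rotations remain. -/
def reductionOutput (k : ℕ) (v : List A) : ℕ → List A → List (Option (CLSymbol A))
  | 0, u => ((emissionList k u v).map some).reverse ++ [none]
  | j + 1, u => reductionOutput k v j (u.rotate 1) ++
      (((emissionList k u v).map some).reverse ++ [none])

theorem reductionRun_rounds {k : ℕ} {v : List A} (j : ℕ) {u : List A} (huv : u.length = v.length) :
    ∃ y S, ReductionRun ((j + 1) * (2 * (k + 2 * v.length) + 4))
      ⟨some .start, (x, none), reductionStacks i o (emissionList k u v) [] c
        (List.replicate j (.inr ()))⟩ ⟨none, y, S⟩ ∧ S .out = reductionOutput k v j u ++ o := by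
  induction j generalizing x o u with
  | zero =>
    have h := (reductionRun_round (x := x) (i := i) (o := o) (k := k) (c := c) (r := []) huv).trans
      (.step (c' := ⟨none, (none, none), reductionStacks i
        (((emissionList k u v).map some).reverse ++ none :: o)
        (emissionList k (u.rotate 1) v) [] c []⟩) (by simp [reductionProgram]) (.refl _))
    refine ⟨(none, none), reductionStacks i (((emissionList k u v).map some).reverse ++ none :: o)
        (emissionList k (u.rotate 1) v) [] c [], ?_, by simp [reductionOutput]⟩
    convert h using 1
    · simp [emissionList, huv]; omega
    · rfl
  | succ j ih =>
    obtain ⟨y, S, h, hS⟩ := ih (x := some (.inr ()))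
      (o := ((emissionList k u v).map some).reverse ++ none :: o) (u := u.rotate 1) (by simpa using huv)
    have h' := (reductionRun_round (x := x) (i := i) (o := o) (k := k) (c := c)
      (r := List.replicate (j + 1) (.inr ())) huv).trans
      (.step (by simp [reductionProgram, List.replicate_succ]) h)
    refine ⟨y, S, ?_, ?_⟩
    · convert h' using 1
      simp [emissionList, huv]; ring
    · simp [hS, reductionOutput]

end Machine

/-! ### Correctness and running time of the reduction -/

section Reduction

variable {A : Type}

theorem reductionRun_main {v w : List A} (k : ℕ) (h : v.length = w.length) :
    ∃ t ≤ (4 * (v.length + 1) + (v.length + 1) * (6 * v.length + 4)), ∃ y S, ReductionRun t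
      ⟨some .readFirst, (none, none), reductionStacks (v.map .inl ++ .inr false ::
        (w.map .inl ++ .inr false :: List.replicate k (.inr true))) [] [] [] [] []⟩
      ⟨none, y, S⟩ ∧ S .out = reductionOutput (min k v.length) v.reverse v.length w := by
  have h₁ := reductionRun_readFirst (x := none) (h := none)
    (i := w.map .inl ++ .inr false :: List.replicate k (.inr true)) (o := []) (f := []) (b := [])
    (c := []) (r := []) v
  have h₂ := reductionRun_readSecond (x := none) (h := none)
    (i := List.replicate k (.inr true)) (o := []) (f := v.reverse.map (fun a => .inl (a, true)) ++ [])
    (b := []) (c := List.replicate v.length (.inr ()) ++ [])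
    (r := List.replicate v.length (.inr ()) ++ []) w
  have h₃ := reductionRun_move (x := none) (h := none)
    (i := List.replicate k (.inr true)) (o := []) (f := v.reverse.map (fun a => .inl (a, true)) ++ [])
    (b := w.reverse.map (fun a => .inl (a, false)) ++ []) (c := List.replicate v.length (.inr ()) ++ [])
    (r := List.replicate v.length (.inr ()) ++ [])
  obtain ⟨t, ht, i', c', h₄⟩ := reductionRun_count (x := none) (h := none) (o := [])
    (f := (w.reverse.map (fun a => Sum.inl (a, false)) ++ []).reverse ++
      (v.reverse.map (fun a => Sum.inl (a, true)) ++ [])) (b := [])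
    (r := List.replicate v.length (.inr ()) ++ []) v.length k
  obtain ⟨y, S, h₅, hS⟩ := reductionRun_rounds (x := none) (i := i') (o := []) (c := c')
    (k := min k v.length) (v := v.reverse) v.length (u := w) (by simp [h])
  simp only [List.append_nil] at h₁ h₂ h₃ h₄ h₅ hS
  have e : List.replicate (min k v.length) (Sum.inr ()) ++
      ((w.reverse.map (fun a => Sum.inl (a, false))).reverse ++
      (v.reverse.map (fun a => Sum.inl (a, true)))) =
        emissionList (min k v.length) w v.reverse := by
    simp [emissionList]
  rw [e] at h₄
  refine ⟨_, ?_, y, S, h₁.trans (h₂.trans (h₃.trans (h₄.trans h₅))), hS⟩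
  have hk : min k v.length ≤ v.length := min_le_right _ _
  have : (v.length + 1) * (2 * (min k v.length + 2 * v.reverse.length) + 4) ≤
      (v.length + 1) * (6 * v.length + 4) := by
    refine Nat.mul_le_mul_left _ ?_
    rw [List.length_reverse]
    omega
  simp only [List.length_map, List.length_reverse] at this ⊢
  omega

/-- The machine that reduces CBI to CL. -/
def reductionMachine (A : Type) [Fintype A] :
    Turing.TM2ComputableAux (A ⊕ Bool) (Option (CLSymbol A)) where
  tm :=
    { k₀ := ReductionStack.inp
      k₁ := ReductionStack.out
      Γ := reductionAlphabet A
      Λ := ReductionLabel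
      main := .readFirst
      σ := ReductionState A
      initialState := (none, none)
      Γk₀Fin := inferInstanceAs (Fintype (A ⊕ Bool))
      m := reductionProgram }
  inputAlphabet := Equiv.refl _
  outputAlphabet := Equiv.refl _

theorem Related.mk_mem_commutator {v w : List A} (h : Related v w) :
    FreeGroup.mk (v.map (·, true) ++ FreeGroup.invRev (w.map (·, true))) ∈
      commutator (FreeGroup A) := by
  rw [← FreeGroup.mul_mk, ← FreeGroup.inv_mk, ← posWord_eq_mk, ← posWord_eq_mk,
    ← Abelianization.ker_of, MonoidHom.mem_ker, map_mul, map_inv, mul_inv_eq_one]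
  simp only [posWord, map_list_prod, List.map_map]
  exact (h.map _).prod_eq

theorem Related.rotate_right {v w : List A} (h : Related v w) (i : ℕ) : Related v (w.rotate i) :=
  List.Perm.trans h (List.rotate_perm w i).symm

/-- The string, ended by `none`, in which an input of CL is written. -/
def encodeCL (p : List (A × Bool) × ℕ) : List (Option (CLSymbol A)) :=
  (p.1.map Sum.inl ++ List.replicate p.2 (Sum.inr ())).map some ++ [none]

/-- A stack is read from the top, so each input is pushed backwards, terminator first, and later
rotations come earlier in the output. -/
theorem reductionOutput_eq (v : List A) (k j : ℕ) (w : List A) :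
    reductionOutput k v.reverse j w = ((List.range (j + 1)).map fun i =>
      (v.map (·, true) ++ FreeGroup.invRev ((w.rotate i).map (·, true)), k)).reverse.flatMap
        encodeCL := by
  have key : ∀ w, ((emissionList k w v.reverse).map some).reverse ++ [none] =
      encodeCL (v.map (·, true) ++ FreeGroup.invRev (w.map (·, true)), k) := fun w => by
    simp [encodeCL, emissionList, FreeGroup.invRev, Function.comp_def]
  induction j generalizing w with
  | zero => simp [reductionOutput, ← key]
  | succ j ih =>
    rw [reductionOutput, ih, key, List.range_succ_eq_map (n := j + 1), List.map_cons,
      List.reverse_cons, List.flatMap_append, List.map_map]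
    simp [Function.comp_def, List.rotate_rotate, Nat.add_comm 1]

variable [Finite A]

/-- The input `(v w⁻¹, k)` of CL. -/
noncomputable def reductionInstance {v w : List A} (h : Related v w) (k : ℕ) : (CLFree A).Instance :=
  ⟨(v.map (·, true) ++ FreeGroup.invRev (w.map (·, true)), k), h.mk_mem_commutator⟩

/-- The list of inputs of CL to which an input of CBI is reduced. -/
noncomputable def reductionMap (x : (CBI A).Instance) : List (CLFree A).Instance :=
  ((List.range (x.1.1.length + 1)).map fun i =>
    reductionInstance (x.2.rotate_right i) (min x.1.2.2 x.1.1.length)).reverse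

theorem encodeList_reductionMap (x : (CBI A).Instance) :
    (CLFree A).encodeList (reductionMap x) =
      reductionOutput (min x.1.2.2 x.1.1.length) x.1.1.reverse x.1.1.length x.1.2.1 := by
  rw [reductionOutput_eq, reductionMap, DecisionProblem.encodeList, ← List.map_reverse,
    List.flatMap_map, ← List.map_reverse, List.flatMap_map]
  rfl

theorem polyTimeComputable_reductionMap :
    PolyTimeComputable (CBI A).size (CBI A).encode (CLFree A).encodeList (reductionMap (A := A)) := by
  have := Fintype.ofFinite A
  refine ⟨reductionMachine A,
    -- Four linear passes prepare the stacks, followed by `|v| + 1` rounds of linear length. The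
    -- extra round repeats a rotation, but provides the one needed when `v` is empty.
    4 * (.X + 1) + (.X + 1) * (6 * .X + 4), ?_, ?_⟩
  · intro k
    change Finite (reductionAlphabet A k)
    cases k <;> infer_instance
  · rintro ⟨⟨v, w, k⟩, h⟩
    obtain ⟨t, ht, y, S, hr, hS⟩ := reductionRun_main k h.length_eq
    refine ⟨⟨none, y, S⟩, ⟨⟨t, ?_⟩, ?_⟩, rfl, ?_⟩
    · have e : Turing.initList (reductionMachine A).tm (((CBI A).encode ⟨(v, w, k), h⟩).map
          (reductionMachine A).inputAlphabet.symm) = (⟨some .readFirst, (none, none),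
          reductionStacks (v.map .inl ++ .inr false :: (w.map .inl ++ .inr false ::
            List.replicate k (.inr true))) [] [] [] [] []⟩ : ReductionCfg A) := by
        refine congrArg (Turing.TM2.Cfg.mk _ _) (funext fun k => ?_)
        cases k
        · exact List.map_id _
        all_goals rfl
      exact (congrArg (fun c => (flip bind (Turing.TM2.step reductionProgram))^[t] (some c)) e).trans
        hr.iterate_eq
    · refine ht.trans ?_
      have hs : v.length ≤ (CBI A).size ⟨(v, w, k), h⟩ := Nat.le_add_right _ _
      simp only [Polynomial.eval_add, Polynomial.eval_mul, Polynomial.eval_X, Polynomial.eval_one,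
        Polynomial.eval_ofNat]
      gcongr
    · have e := encodeList_reductionMap ⟨(v, w, k), h⟩
      exact (hS.trans e.symm).trans (List.map_id _).symm

/-- Capping k at `|v|` is harmless because the distance never exceeds `|v|`; the minimum over
rotations becomes the disjunction. -/
theorem yes_iff_exists_mem_reductionMap (x : (CBI A).Instance) :
    (CBI A).Yes x ↔ ∃ y ∈ reductionMap x, (CLFree A).Yes y := by
  obtain ⟨⟨v, w, k⟩, h⟩ := x
  have h : Related v w := h
  have h₀ : (CBI A).Yes ⟨(v, w, k), h⟩ ↔ CbiReach (min k v.length) v w := by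
    change cbiDist v w ≤ k ↔ _
    rw [← cbiDist_le_iff]
    have := h.cbiDist_le_length
    rcases le_total k v.length with hk | hk
    · rw [min_eq_left hk]
    · rw [min_eq_right hk]
      exact iff_of_true (this.trans (by exact_mod_cast hk)) this
  have h₁ : ∀ {w'} (h' : Related v w') (j : ℕ), (CLFree A).Yes (reductionInstance h' j) ↔
      IsCommutatorProd j (posWord v * (posWord w')⁻¹) := fun {w'} h' j => by
    change commutatorLength _ ≤ _ ↔ _
    rw [commutatorLength_le_iff]
    simp only [reductionInstance]
    rw [← FreeGroup.mul_mk, ← FreeGroup.inv_mk, ← posWord_eq_mk, ← posWord_eq_mk]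
  rw [h₀, h.cbiReach_iff]
  simp only [reductionMap, List.mem_reverse, List.mem_map, List.mem_range]
  constructor
  · rintro ⟨w', hw, hk⟩
    obtain ⟨i, hi, rfl⟩ := List.isRotated_iff_mod.1 hw
    exact ⟨_, ⟨i, by rw [h.length_eq]; omega, rfl⟩, (h₁ _ _).2 hk⟩
  · rintro ⟨_, ⟨i, -, rfl⟩, hy⟩
    exact ⟨w.rotate i, ⟨i, rfl⟩, (h₁ _ _).1 hy⟩

end Reduction

theorem theorem2 :
    (∀ (A : Type*) (v w : List A), Related v w →
      cbiDist v w = chainCommutatorLength [posWord v, (posWord w)⁻¹] ∧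
      cbiDist v w ≠ ⊤ ∧
      IsLeast {m : ℕ∞ | ∃ w' : List A, w.IsRotated w' ∧
          m = commutatorLength (posWord v * (posWord w')⁻¹)}
        (chainCommutatorLength [posWord v, (posWord w)⁻¹])) ∧
    (∀ (A : Type) [Finite A], PolyTimeReducible (CBI A) (CLFree A)) :=
  ⟨fun _ _ _ h => ⟨h.cbiDist_eq, ne_top_of_le_ne_top (ENat.natCast_ne_top _) h.cbiDist_le_length,
    h.isLeast_chainCommutatorLength⟩,
    fun _ _ => ⟨reductionMap, polyTimeComputable_reductionMap, yes_iff_exists_mem_reductionMap⟩⟩
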